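/- Let $\mathbb D$ be the open unit disk in $\mathbb C$, let $dA=\pi^{-1}\,dx\,dy$ be the normalized area measure on $\mathbb D$, and let the Bergman space $L_a^2$ be the space of holomorphic functions $f$ on $\mathbb D$ with $\int_{\mathbb D}|f|^2\,dA<\infty$. For $z,w\in\mathbb D$ let $\rho(z,w)=\left|\frac{w-z}{1-\overline w z}\right|$ be the pseudo-hyperbolic distance, $\beta(z,w)=\tanh^{-1}\rho(z,w)$ the Bergman distance, and $D(w,r)=\{z\in\mathbb D:\beta(w,z)<r\}$. A finite positive Borel measure $\mu$ on $\mathbb D$ is called a reverse Carleson measure for $L_a^2$ if there is a constant $C>0$ such that $\int_{\mathbb D}|f|^2\,d\mu\ge C\int_{\mathbb D}|f|^2\,dA$ for all $f\in L_a^2$. For $R>0$, consider sequences $\{b_k\}_{k=1}^\infty$ in $\mathbb D$ such that $$\mathbb D=\bigcup_{k=1}^\infty D(b_k,R)\qquad\text{and}\qquad \beta(b_k,b_j)\ge \tfrac R2\quad (k\ne j),$$ and put $\mu_0=\sum_{k=1}^\infty(1-|b_k|^2)^2\,\delta_{b_k}$, where $\delta_{b}$ is the unit point mass at $b$. For every $R>0$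 and every such sequence, $\mu_0$ is a finite measure. Moreover, there are absolute constants $R_0>0$ and $R_1>0$ such that: (a) if $0<R<R_0$, then for every such sequence $\mu_0$ is a reverse Carleson measure for $L_a^2$; (b) if $R>R_1$, then for every such sequence $\mu_0$ is not a reverse Carleson measure for $L_a^2$. -/

import Mathlib

open MeasureTheory

namespace Bergman

/-- The open unit disk `𝔻` in the complex plane. -/
def disk : Set ℂ := Metric.ball 0 1

/-- The normalized area measure `dA = π⁻¹ dx dy` on the disk, so that `A(𝔻) = 1`
(a measure on `ℂ` concentrated on `𝔻`). -/
noncomputable def area : Measure ℂ :=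
  ENNReal.ofReal (Real.pi⁻¹) • (volume : Measure ℂ).restrict disk

/-- The Möbius transform `φ_w(z) = (w - z) / (1 - w̄ z)`. -/
noncomputable def mobius (w z : ℂ) : ℂ := (w - z) / (1 - (starRingEnd ℂ) w * z)

/-- The pseudo-hyperbolic distance `ρ(z, w) = |φ_w(z)|`. -/
noncomputable def rho (z w : ℂ) : ℝ := ‖mobius w z‖

/-- The Bergman distance `β(z, w) = tanh⁻¹ ρ(z, w)`. -/
noncomputable def beta (z w : ℂ) : ℝ := Real.artanh (rho z w)

/-- The Bergman disk `D(w, r) = {z ∈ 𝔻 : β(w, z) < r}`. -/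
def bergmanDisk (w : ℂ) (r : ℝ) : Set ℂ := {z ∈ disk | beta w z < r}

/-- Membership in the Bergman space `L_a²`: holomorphic on the disk and square integrable there
(the values of `f` outside the disk are irrelevant). -/
def MemBergman (f : ℂ → ℂ) : Prop := DifferentiableOn ℂ f disk ∧ MemLp f 2 area

/-- `μ` is a reverse Carleson measure for `L_a²`: for some constant `C > 0`,
`∫_𝔻 |f|² dμ ≥ C ∫_𝔻 |f|² dA` for all `f ∈ L_a²` (both sides in `[0, ∞]`). -/
def IsReverseCarleson (μ : Measure ℂ) : Prop :=
  ∃ C : ℝ, 0 < C ∧ ∀ f : ℂ → ℂ, MemBergman f →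
    ENNReal.ofReal C * ∫⁻ z in disk, ‖f z‖ₑ ^ 2 ∂area ≤ ∫⁻ z in disk, ‖f z‖ₑ ^ 2 ∂μ

/-- A sequence in the disk with `𝔻 = ⋃ D(b_k, R)` and `β(b_k, b_j) ≥ R / 2` for `k ≠ j`. -/
structure IsLattice (R : ℝ) (b : ℕ → ℂ) : Prop where
  mem_disk : ∀ k, b k ∈ disk
  cover : disk = ⋃ k, bergmanDisk (b k) R
  separated : ∀ k j, k ≠ j → R / 2 ≤ beta (b k) (b j)

/-- The measure `∑ (1 - |b_k|²)² δ_{b_k}`. -/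
noncomputable def pointMeasure (b : ℕ → ℂ) : Measure ℂ :=
  Measure.sum fun k => ENNReal.ofReal ((1 - ‖b k‖ ^ 2) ^ 2) • Measure.dirac (b k)

end Bergman

open MeasureTheory Metric Set
open scoped ENNReal ComplexConjugate BoundedContinuousFunction

namespace Bergman

/-! Separation makes Euclidean disks about `b k`, with radii a fixed multiple of 1 - |b_k|,
disjoint. The weights (1 - |b_k|²)² are then comparable to areas of disjoint sets, which gives
finiteness, and sums over the points are dominated by area integrals
(`Separated.tsum_volume_ball_mul_le`).

Small R: put t = tanh R. The disks of radius 4t(1 - |b_k|) cover 𝔻, and on each of them f differs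
from f(b_k) by O(t) times its local L² average (`enorm_sub_sq_le`: Schwarz lemma and sub-mean value
property). Each disk has area of order t²(1 - |b_k|)², and the larger disks of radius (1 - |b_k|)/2
overlap O(t⁻²) times (`Separated.tsum_indicator_ball_le`). The total error is thus O(t²)∫|f|², which
is absorbed for small t.

Large R: the points become so sparse that a nonzero f ∈ L_a² vanishes at all of them, which rules
out a lower bound. One seeks g = ∑ w_k e_k K_k with K_k a normalized kernel power, w_k = (1 -
|b_k|)^(-1/4) and (e_k) bounded, such that g is 1 at `b 0` and 0 at the other points. A
Forelli–Rudin estimate (`Separated.tsum_offDiagonal_le`) makes this infinite system diagonally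
dominant, so it is solved by contraction in ℓ^∞ (`exists_bounded_solution`). The growth |g| ≲ (1 -
|z|)^(-1/4) puts g in L², and f = (z - b_0)g. -/

/-! ### Pseudo-hyperbolic geometry and its Euclidean form for lattices. -/

theorem mem_disk_iff {z : ℂ} : z ∈ disk ↔ ‖z‖ < 1 := by simp [disk]

theorem one_sub_conj_mul_ne_zero {w z : ℂ} (hw : ‖w‖ < 1) (hz : ‖z‖ < 1) :
    1 - conj w * z ≠ 0 := by
  intro h
  have h1 : conj w * z = 1 := (sub_eq_zero.1 h).symm
  have h2 : ‖w‖ * ‖z‖ = 1 := by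
    have := congrArg norm h1
    simpa using this
  nlinarith [norm_nonneg w, norm_nonneg z]

theorem norm_one_sub_conj_mul_pos {w z : ℂ} (hw : ‖w‖ < 1) (hz : ‖z‖ < 1) :
    0 < ‖1 - conj w * z‖ :=
  norm_pos_iff.2 (one_sub_conj_mul_ne_zero hw hz)

theorem one_sub_norm_mul_le (w z : ℂ) : 1 - ‖w‖ * ‖z‖ ≤ ‖1 - conj w * z‖ := by
  have := norm_sub_norm_le (1 : ℂ) (conj w * z)
  simpa using this

theorem one_sub_norm_le_left {w z : ℂ} (hz : ‖z‖ < 1) : 1 - ‖w‖ ≤ ‖1 - conj w * z‖ := by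
  have := one_sub_norm_mul_le w z
  nlinarith [norm_nonneg w, norm_nonneg z]

theorem one_sub_norm_le_right {w z : ℂ} (hw : ‖w‖ < 1) : 1 - ‖z‖ ≤ ‖1 - conj w * z‖ := by
  have := one_sub_norm_mul_le w z
  nlinarith [norm_nonneg w, norm_nonneg z]

/-- Equivalent to 1 - ρ² = (1 - |w|²)(1 - |z|²)/|1 - w̄z|². It gives ρ < 1, and later turns
hyperbolic separation into smallness of off-diagonal kernels. -/
theorem norm_one_sub_conj_mul_sq (w z : ℂ) :
    ‖1 - conj w * z‖ ^ 2 = ‖w - z‖ ^ 2 + (1 - ‖w‖ ^ 2) * (1 - ‖z‖ ^ 2) := by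
  simp only [Complex.sq_norm, Complex.normSq_apply]
  simp
  ring

theorem rho_eq_div (w z : ℂ) : rho w z = ‖w - z‖ / ‖1 - conj w * z‖ := by
  rw [rho, mobius, norm_div, norm_sub_rev, ← Complex.norm_conj (1 - conj z * w)]
  simp [mul_comm]

theorem rho_mem_Ico {w z : ℂ} (hw : ‖w‖ < 1) (hz : ‖z‖ < 1) : rho w z ∈ Ico (0 : ℝ) 1 := by
  refine ⟨norm_nonneg _, ?_⟩
  have hp := norm_one_sub_conj_mul_pos hw hz
  rw [rho_eq_div, div_lt_one hp]
  have h := norm_one_sub_conj_mul_sq w z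
  refine lt_of_pow_lt_pow_left₀ 2 hp.le ?_
  have : 0 < (1 - ‖w‖ ^ 2) * (1 - ‖z‖ ^ 2) := by
    apply mul_pos <;> nlinarith [norm_nonneg w, norm_nonneg z]
  linarith

theorem tanh_strictMono : StrictMono Real.tanh := by
  intro x y h
  have hx : Real.tanh x ∈ Ioo (-1 : ℝ) 1 := ⟨Real.neg_one_lt_tanh x, Real.tanh_lt_one x⟩
  have hy : Real.tanh y ∈ Ioo (-1 : ℝ) 1 := ⟨Real.neg_one_lt_tanh y, Real.tanh_lt_one y⟩
  rw [← Real.artanh_lt_artanh_iff hx hy]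
  simpa [Real.artanh_tanh] using h

theorem tanh_pos {x : ℝ} (hx : 0 < x) : 0 < Real.tanh x := by
  simpa using tanh_strictMono hx

/-- Follows from the duplication formula. It allows the separation scale R/2 and the covering scale
R to be measured by the single parameter tanh R. -/
theorem tanh_le_two_mul_tanh_half {x : ℝ} (hx : 0 < x) :
    Real.tanh x ≤ 2 * Real.tanh (x / 2) := by
  have h0 := tanh_pos (half_pos hx)
  have e : ∀ y : ℝ, Real.tanh (2 * y) * (1 + Real.tanh y ^ 2) = 2 * Real.tanh y := by
    intro y
    have hc := (Real.cosh_pos y).ne'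
    have hs : Real.cosh y ^ 2 + Real.sinh y ^ 2 ≠ 0 := by positivity
    rw [Real.tanh_eq_sinh_div_cosh (2 * y), Real.sinh_two_mul, Real.cosh_two_mul,
      Real.tanh_eq_sinh_div_cosh]
    field_simp
  have e := e (x / 2)
  rw [mul_div_cancel₀ x two_ne_zero] at e
  have h3 := tanh_pos hx
  nlinarith [sq_nonneg (Real.tanh (x / 2)), mul_pos h3 (sq_pos_of_pos h0)]

namespace IsLattice
variable {R : ℝ} {b : ℕ → ℂ}

theorem norm_lt_one (h : IsLattice R b) (k : ℕ) : ‖b k‖ < 1 := mem_disk_iff.1 (h.mem_disk k)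

theorem tanh_mul_le (h : IsLattice R b) {k j : ℕ} (hkj : k ≠ j) :
    Real.tanh (R / 2) * ‖1 - conj (b k) * b j‖ ≤ ‖b k - b j‖ := by
  have hr := rho_mem_Ico (h.norm_lt_one k) (h.norm_lt_one j)
  have h1 := tanh_strictMono.monotone (h.separated k j hkj)
  rw [beta, Real.tanh_artanh ⟨by linarith [hr.1], hr.2⟩, rho_eq_div,
    le_div_iff₀ (norm_one_sub_conj_mul_pos (h.norm_lt_one k) (h.norm_lt_one j))] at h1
  exact h1

theorem exists_norm_sub_lt (h : IsLattice R b) {z : ℂ} (hz : ‖z‖ < 1) :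
    ∃ k, ‖b k - z‖ < Real.tanh R * ‖1 - conj (b k) * z‖ := by
  have hz' : z ∈ disk := mem_disk_iff.2 hz
  rw [h.cover] at hz'
  obtain ⟨k, -, hk⟩ := mem_iUnion.1 hz'
  refine ⟨k, ?_⟩
  have hr := rho_mem_Ico (h.norm_lt_one k) hz
  have h1 := tanh_strictMono hk
  rwa [beta, Real.tanh_artanh ⟨by linarith [hr.1], hr.2⟩, rho_eq_div,
    div_lt_iff₀ (norm_one_sub_conj_mul_pos (h.norm_lt_one k) hz)] at h1

end IsLattice

/-! ### Separated sequences, comparison with area, and finiteness of μ₀. -/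

/-- The points of `b` lie in the disk and are separated at the scale of their distance to the
unit circle, with constant `s`. -/
structure Separated (s : ℝ) (b : ℕ → ℂ) : Prop where
  norm_lt_one : ∀ k, ‖b k‖ < 1
  le_norm_sub : ∀ k j, k ≠ j → s * (1 - ‖b k‖) ≤ ‖b k - b j‖

theorem IsLattice.toSeparated {R s : ℝ} {b : ℕ → ℂ} (h : IsLattice R b) (hs : 0 ≤ s)
    (hsR : s ≤ Real.tanh (R / 2)) : Separated s b where
  norm_lt_one := h.norm_lt_one
  le_norm_sub k j hkj := by
    refine le_trans ?_ (h.tanh_mul_le hkj)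
    exact mul_le_mul hsR (one_sub_norm_le_left (h.norm_lt_one j))
      (by linarith [h.norm_lt_one k]) (hs.trans hsR)

namespace Separated
variable {s : ℝ} {b : ℕ → ℂ}

theorem pairwise_disjoint_ball (h : Separated s b) :
    Pairwise (Function.onFun Disjoint fun k => ball (b k) (s / 2 * (1 - ‖b k‖))) := by
  intro k j hkj
  apply ball_disjoint_ball
  rw [dist_eq_norm]
  have h1 := h.le_norm_sub k j hkj
  have h2 := h.le_norm_sub j k hkj.symm
  rw [norm_sub_rev] at h2
  linarith

theorem ball_subset_disk (h : Separated s b) (hs : s ≤ 1) (k : ℕ) :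
    ball (b k) (s / 2 * (1 - ‖b k‖)) ⊆ disk := by
  intro w hw
  rw [mem_ball, dist_eq_norm] at hw
  rw [mem_disk_iff]
  have h1 := h.norm_lt_one k
  have h2 : ‖w‖ ≤ ‖w - b k‖ + ‖b k‖ := by simpa using norm_add_le (w - b k) (b k)
  nlinarith

/-- Discrete sums are controlled by area integrals. -/
theorem tsum_volume_ball_mul_le (h : Separated s b) (hs : s ≤ 1) {G : ℕ → ℝ≥0∞} {g : ℂ → ℝ≥0∞}
    (hG : ∀ k, ∀ w ∈ ball (b k) (s / 2 * (1 - ‖b k‖)), G k ≤ g w) :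
    ∑' k, volume (ball (b k) (s / 2 * (1 - ‖b k‖))) * G k ≤ ∫⁻ w in disk, g w := by
  calc ∑' k, volume (ball (b k) (s / 2 * (1 - ‖b k‖))) * G k
      ≤ ∑' k, ∫⁻ w in ball (b k) (s / 2 * (1 - ‖b k‖)), g w := by
        refine ENNReal.tsum_le_tsum fun k => ?_
        rw [mul_comm, ← setLIntegral_const]
        exact setLIntegral_mono' measurableSet_ball fun w hw => hG k w hw
    _ = ∫⁻ w in ⋃ k, ball (b k) (s / 2 * (1 - ‖b k‖)), g w :=
        (lintegral_iUnion (fun k => measurableSet_ball) h.pairwise_disjoint_ball g).symm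
    _ ≤ ∫⁻ w in disk, g w :=
        lintegral_mono_set (iUnion_subset fun k => h.ball_subset_disk hs k)

theorem volume_ball (h : Separated s b) (hs : 0 ≤ s) (k : ℕ) :
    volume (ball (b k) (s / 2 * (1 - ‖b k‖))) =
      ENNReal.ofReal (Real.pi * s ^ 2 / 4 * (1 - ‖b k‖) ^ 2) := by
  have h1 := h.norm_lt_one k
  rw [Complex.volume_ball, ← ENNReal.ofReal_pow (by apply mul_nonneg <;> linarith),
    ← NNReal.coe_real_pi, ← ENNReal.ofReal_coe_nnreal, ← ENNReal.ofReal_mul (by positivity)]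
  congr 1
  ring

end Separated

theorem volume_disk_lt_top : volume disk < ∞ := measure_ball_lt_top

theorem measurableSet_disk : MeasurableSet disk := measurableSet_ball

theorem isOpen_disk : IsOpen disk := isOpen_ball

theorem setLIntegral_pointMeasure {b : ℕ → ℂ} (hb : ∀ k, b k ∈ disk) (g : ℂ → ℝ≥0∞) :
    ∫⁻ z in disk, g z ∂pointMeasure b =
      ∑' k, ENNReal.ofReal ((1 - ‖b k‖ ^ 2) ^ 2) * g (b k) := by
  classical
  rw [pointMeasure, Measure.restrict_sum _ measurableSet_disk, lintegral_sum_measure]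
  refine tsum_congr fun k => ?_
  rw [Measure.restrict_smul, lintegral_smul_measure, setLIntegral_dirac, if_pos (hb k),
    smul_eq_mul]

theorem one_sub_sq_sq_le {x : ℝ} (h0 : 0 ≤ x) (h1 : x < 1) :
    (1 - x ^ 2) ^ 2 ≤ 4 * (1 - x) ^ 2 := by
  nlinarith [mul_nonneg (sq_nonneg (1 - x)) (show 0 ≤ 4 - (1 + x) ^ 2 by nlinarith)]

theorem isFiniteMeasure_pointMeasure {R : ℝ} {b : ℕ → ℂ} (hR : 0 < R) (h : IsLattice R b) :
    IsFiniteMeasure (pointMeasure b) := by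
  have ht := tanh_pos (half_pos hR)
  have hsep := h.toSeparated ht.le le_rfl
  have key := hsep.tsum_volume_ball_mul_le (Real.tanh_lt_one _).le (G := fun _ => 1)
    (g := fun _ => 1) (fun _ _ _ => le_rfl)
  refine ⟨?_⟩
  simp only [pointMeasure, Measure.sum_apply _ MeasurableSet.univ, Measure.smul_apply,
    measure_univ, smul_eq_mul, mul_one]
  simp only [mul_one, lintegral_const, Measure.restrict_apply MeasurableSet.univ, univ_inter,
    one_mul] at key
  set s := Real.tanh (R / 2)
  have h2 : ∀ k, ENNReal.ofReal ((1 - ‖b k‖ ^ 2) ^ 2) ≤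
      ENNReal.ofReal (16 / (Real.pi * s ^ 2)) *
        volume (ball (b k) (s / 2 * (1 - ‖b k‖))) := by
    intro k
    rw [hsep.volume_ball ht.le, ← ENNReal.ofReal_mul (by positivity)]
    apply ENNReal.ofReal_le_ofReal
    refine (one_sub_sq_sq_le (norm_nonneg _) (h.norm_lt_one k)).trans (le_of_eq ?_)
    field_simp
    ring
  refine (ENNReal.tsum_le_tsum h2).trans_lt ?_
  rw [ENNReal.tsum_mul_left]
  exact ENNReal.mul_lt_top ENNReal.ofReal_lt_top (key.trans_lt volume_disk_lt_top)

/-! ### Polar coordinates and the sub-mean value property. -/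

theorem polarCoord_symm_eq_circleMap (p : ℝ × ℝ) :
    Complex.polarCoord.symm p = circleMap 0 p.1 p.2 := by
  rw [Complex.polarCoord_symm_apply, circleMap, zero_add, Complex.exp_mul_I]
  simp

theorem lintegral_angle_eq_circleAverage {h : ℂ → ℝ} {c : ℂ} {r : ℝ} (h0 : ∀ z, 0 ≤ h z)
    (hi : CircleIntegrable h c r) :
    ∫⁻ θ in Ioo (-Real.pi) Real.pi, ENNReal.ofReal (h (circleMap c r θ)) =
      ENNReal.ofReal (2 * Real.pi * Real.circleAverage h c r) := by
  have hp : Function.Periodic (fun θ => h (circleMap c r θ)) (2 * Real.pi) := fun θ => by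
    simp only [periodic_circleMap c r θ]
  have e := hp.intervalIntegral_add_eq (-Real.pi) 0
  have hint : IntervalIntegrable (fun θ => h (circleMap c r θ)) volume (-Real.pi) Real.pi := by
    have : IntervalIntegrable (fun θ => h (circleMap c r θ)) volume 0 (0 + 2 * Real.pi) := by
      rw [zero_add]; exact hi
    exact hp.intervalIntegrable Real.two_pi_pos.ne' this _ _
  have hpi : -Real.pi ≤ Real.pi := by linarith [Real.pi_pos]
  rw [show -Real.pi + 2 * Real.pi = Real.pi by ring, zero_add,
    intervalIntegral.integral_of_le hpi, integral_Ioc_eq_integral_Ioo] at e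
  rw [intervalIntegrable_iff_integrableOn_Ioo_of_le hpi] at hint
  rw [← ofReal_integral_eq_lintegral_ofReal hint (Filter.Eventually.of_forall fun θ => h0 _), e,
    Real.circleAverage, smul_eq_mul, mul_inv_cancel_left₀ Real.two_pi_pos.ne']

/-- Integration over a disk in polar coordinates. -/
theorem lintegral_ball_eq_lintegral_circleAverage {h : ℂ → ℝ} {c : ℂ} {R : ℝ} (h0 : ∀ z, 0 ≤ h z)
    (hc : ContinuousOn h (ball c R)) :
    ∫⁻ z in ball c R, ENNReal.ofReal (h z) =
      ∫⁻ r in Ioo 0 R, ENNReal.ofReal (2 * Real.pi * r * Real.circleAverage h c r) := by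
  classical
  -- Extension by zero gives a globally measurable function, although `h` is controlled only on the
  -- ball.
  set g : ℂ → ℝ≥0∞ := (ball c R).indicator fun z => ENNReal.ofReal (h z) with hg
  have hgm : Measurable g := by
    have h1 : ContinuousOn (fun z => ENNReal.ofReal (h z)) (ball c R) :=
      ENNReal.continuous_ofReal.comp_continuousOn hc
    have := h1.measurable_piecewise (g := fun _ => 0) continuousOn_const measurableSet_ball
    convert this using 1
    ext z
    by_cases hz : z ∈ ball c R <;> simp [g, hz]
  rw [← lintegral_indicator measurableSet_ball, ← hg,
    ← lintegral_add_left_eq_self (μ := (volume : Measure ℂ)) g c,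
    ← Complex.lintegral_comp_polarCoord_symm, polarCoord_target, Measure.volume_eq_prod,
    setLIntegral_prod]
  · have hsub : Ioo (0 : ℝ) R ⊆ Ioi 0 := fun r hr => hr.1
    rw [← lintegral_indicator measurableSet_Ioi, ← lintegral_indicator measurableSet_Ioo]
    congr 1
    ext r
    by_cases hr : r ∈ Ioi (0 : ℝ)
    · have hr' : 0 < r := hr
      rw [indicator_of_mem hr]
      by_cases hrR : r < R
      · rw [indicator_of_mem (show r ∈ Ioo 0 R from ⟨hr, hrR⟩)]
        have hmem : ∀ θ, circleMap c r θ ∈ ball c R := fun θ => by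
          rw [mem_ball, dist_eq_norm, circleMap_sub_center]
          simpa [abs_of_pos hr'] using hrR
        have hci : CircleIntegrable h c r := by
          refine ContinuousOn.circleIntegrable hr'.le (hc.mono fun z hz => ?_)
          rw [mem_ball, mem_sphere.1 hz]; exact hrR
        calc ∫⁻ θ in Ioo (-Real.pi) Real.pi,
              ENNReal.ofReal r • g (c + Complex.polarCoord.symm (r, θ))
            = ∫⁻ θ in Ioo (-Real.pi) Real.pi,
              ENNReal.ofReal r * ENNReal.ofReal (h (circleMap c r θ)) := by
              refine lintegral_congr fun θ => ?_
              have e : c + Complex.polarCoord.symm (r, θ) = circleMap c r θ := by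
                rw [polarCoord_symm_eq_circleMap]; simp [circleMap]
              rw [e, smul_eq_mul, hg, indicator_of_mem (hmem θ)]
          _ = ENNReal.ofReal (2 * Real.pi * r * Real.circleAverage h c r) := by
              rw [lintegral_const_mul' _ _ ENNReal.ofReal_ne_top,
                lintegral_angle_eq_circleAverage h0 hci, ← ENNReal.ofReal_mul hr'.le]
              congr 1
              ring
      · rw [indicator_of_notMem (fun h => hrR h.2)]
        refine (lintegral_congr fun θ => ?_).trans lintegral_zero
        have : c + Complex.polarCoord.symm (r, θ) ∉ ball c R := by
          rw [polarCoord_symm_eq_circleMap, mem_ball, dist_eq_norm]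
          simpa [abs_of_pos hr'] using hrR
        rw [hg, indicator_of_notMem this, smul_zero]
    · rw [indicator_of_notMem hr, indicator_of_notMem (fun h => hr h.1)]
  · have hcont : Continuous (Complex.polarCoord.symm : ℝ × ℝ → ℂ) := by
      have : (Complex.polarCoord.symm : ℝ × ℝ → ℂ) = fun p => circleMap 0 p.1 p.2 :=
        funext polarCoord_symm_eq_circleMap
      rw [this]
      simp only [circleMap]
      fun_prop
    refine Measurable.aemeasurable ?_
    exact (ENNReal.measurable_ofReal.comp measurable_fst).smul
      (hgm.comp (measurable_const.add hcont.measurable))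

/-- The sub-mean value property of `|f|²` over disks. -/
theorem volume_ball_mul_sq_le {f : ℂ → ℂ} {c : ℂ} {R : ℝ} (hf : DifferentiableOn ℂ f (ball c R)) :
    volume (ball c R) * ‖f c‖ₑ ^ 2 ≤ ∫⁻ z in ball c R, ‖f z‖ₑ ^ 2 := by
  have e : ∀ z, ‖f z‖ₑ ^ 2 = ENNReal.ofReal (‖f z‖ ^ 2) := fun z => by
    rw [← ofReal_norm, ENNReal.ofReal_pow (norm_nonneg _)]
  simp only [e]
  rw [lintegral_ball_eq_lintegral_circleAverage (fun z => sq_nonneg _)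
    (hf.continuousOn.norm.pow 2)]
  calc volume (ball c R) * ENNReal.ofReal (‖f c‖ ^ 2)
      = ∫⁻ z in ball c R, ENNReal.ofReal (‖f c‖ ^ 2) := by rw [setLIntegral_const, mul_comm]
    _ = ∫⁻ r in Ioo 0 R, ENNReal.ofReal (2 * Real.pi * r *
          Real.circleAverage (fun _ => ‖f c‖ ^ 2) c r) :=
        lintegral_ball_eq_lintegral_circleAverage (fun z => sq_nonneg _) continuousOn_const
    _ ≤ _ := by
        refine setLIntegral_mono' measurableSet_Ioo fun r hr => ?_
        apply ENNReal.ofReal_le_ofReal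
        have hr0 : 0 < r := hr.1
        refine mul_le_mul_of_nonneg_left ?_ (by positivity)
        rw [Real.circleAverage_const]
        -- The mean value property is applied to the holomorphic f², so that |f²| = |f|² needs only
        -- the triangle inequality.
        have hd : DiffContOnCl ℂ (fun z => f z ^ 2) (ball c |r|) := by
          refine DifferentiableOn.diffContOnCl ?_
          rw [abs_of_pos hr0, closure_ball _ hr0.ne']
          exact (hf.mono (closedBall_subset_ball hr.2)).pow 2
        have h1 := hd.circleAverage
        rw [← norm_pow, ← h1, Real.circleAverage, Real.circleAverage, norm_smul, smul_eq_mul,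
          Real.norm_of_nonneg (by positivity)]
        refine mul_le_mul_of_nonneg_left ?_ (by positivity)
        refine (intervalIntegral.norm_integral_le_integral_norm Real.two_pi_pos.le).trans_eq ?_
        simp

/-! ### The Forelli–Rudin estimate on the disk. -/

/-- On |w| = r, (1 - r²|z|²)/|1 - w̄z|² is a Poisson kernel: the real part of (1 + wz̄)/(1 - wz̄),
whose circle average is its value 1 at w = 0. -/
theorem circleAverage_inv_norm_sq {z : ℂ} {r : ℝ} (hr0 : 0 < r) (hr : r < 1) (hz : ‖z‖ < 1) :
    Real.circleAverage (fun w => (‖1 - conj w * z‖ ^ 2)⁻¹) 0 r = (1 - r ^ 2 * ‖z‖ ^ 2)⁻¹ := by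
  have hrz : r * ‖z‖ < 1 := by nlinarith [norm_nonneg z]
  have hpos : 0 < 1 - r ^ 2 * ‖z‖ ^ 2 := by nlinarith [mul_nonneg hr0.le (norm_nonneg z)]
  have hne : ∀ w : ℂ, ‖w‖ ≤ r → 1 - w * conj z ≠ 0 := by
    intro w hw h
    have h2 : ‖w‖ * ‖z‖ = 1 := by
      simpa using (congrArg norm (sub_eq_zero.1 h)).symm
    nlinarith [norm_nonneg z]
  have hd : DifferentiableOn ℂ (fun w => (1 + w * conj z) / (1 - w * conj z))
      (closedBall 0 r) := by
    refine DifferentiableOn.div (by fun_prop) (by fun_prop) fun w hw => ?_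
    exact hne w (by simpa using hw)
  have hd' : DiffContOnCl ℂ (fun w => (1 + w * conj z) / (1 - w * conj z)) (ball 0 |r|) := by
    refine DifferentiableOn.diffContOnCl ?_
    rwa [abs_of_pos hr0, closure_ball _ hr0.ne']
  have h1 := hd'.circleAverage
  have hci : CircleIntegrable (fun w => (1 + w * conj z) / (1 - w * conj z)) 0 r :=
    ContinuousOn.circleIntegrable hr0.le (hd.continuousOn.mono sphere_subset_closedBall)
  have h2 := Complex.reCLM.circleAverage_comp_comm hci
  rw [h1] at h2
  have h3 : Real.circleAverage (fun w => (‖1 - conj w * z‖ ^ 2)⁻¹) 0 r =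
      Real.circleAverage (fun w => (1 - r ^ 2 * ‖z‖ ^ 2)⁻¹ •
        (Complex.reCLM ∘ fun w => (1 + w * conj z) / (1 - w * conj z)) w) 0 r := by
    refine Real.circleAverage_congr_sphere fun w hw => ?_
    rw [abs_of_pos hr0, mem_sphere_zero_iff_norm] at hw
    have hn := hne w hw.le
    have e1 : ‖1 - conj w * z‖ ^ 2 = Complex.normSq (1 - w * conj z) := by
      rw [← Complex.norm_conj, Complex.sq_norm]; simp
    have hw2 : w.re * w.re + w.im * w.im = r ^ 2 := by
      rw [← hw, Complex.sq_norm, Complex.normSq_apply]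
    have hz2 : z.re * z.re + z.im * z.im = ‖z‖ ^ 2 := by
      rw [Complex.sq_norm, Complex.normSq_apply]
    have hN : Complex.normSq (1 - w * conj z) ≠ 0 := by rwa [Ne, Complex.normSq_eq_zero]
    have e2 : ((1 + w * conj z) / (1 - w * conj z)).re =
        (1 - r ^ 2 * ‖z‖ ^ 2) / Complex.normSq (1 - w * conj z) := by
      rw [Complex.div_re, ← add_div]
      congr 1
      rw [← hw2, ← hz2]
      simp
      ring
    simp only [Function.comp_apply, Complex.reCLM_apply, smul_eq_mul]
    rw [e1, e2]
    field_simp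
  rw [h3, Real.circleAverage_fun_smul]
  rw [h2]
  simp

/-- Split at u = y: below, integrability at 0 needs γ < 1; above, decay at infinity needs γ > 0. -/
theorem lintegral_rpow_div_max_le {γ y : ℝ} (h0 : 0 < γ) (h1 : γ < 1) (hy : 0 < y) :
    ∫⁻ u in Ioi 0, ENNReal.ofReal (u ^ (-γ) / max u y) ≤
      ENNReal.ofReal ((1 / (1 - γ) + 1 / γ) * y ^ (-γ)) := by
  rw [← Ioc_union_Ioi_eq_Ioi hy.le, add_mul, ENNReal.ofReal_add]
  rotate_left
  · have : 0 < 1 - γ := by linarith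
    positivity
  · positivity
  refine (lintegral_union_le _ _ _).trans (add_le_add ?_ ?_)
  · have hi : IntervalIntegrable (fun u : ℝ => u ^ (-γ) / y) volume 0 y :=
      (intervalIntegral.intervalIntegrable_rpow' (by linarith)).div_const y
    rw [intervalIntegrable_iff_integrableOn_Ioc_of_le hy.le] at hi
    calc ∫⁻ u in Ioc 0 y, ENNReal.ofReal (u ^ (-γ) / max u y)
        ≤ ∫⁻ u in Ioc 0 y, ENNReal.ofReal (u ^ (-γ) / y) := by
          refine setLIntegral_mono' measurableSet_Ioc fun u hu => ENNReal.ofReal_le_ofReal ?_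
          rw [max_eq_right hu.2]
      _ = ENNReal.ofReal (∫ u in Ioc 0 y, u ^ (-γ) / y) := by
          rw [ofReal_integral_eq_lintegral_ofReal hi]
          filter_upwards [ae_restrict_mem measurableSet_Ioc] with u hu
          have : 0 < u := hu.1
          positivity
      _ ≤ _ := by
          apply ENNReal.ofReal_le_ofReal
          rw [← intervalIntegral.integral_of_le hy.le, intervalIntegral.integral_div,
            integral_rpow (Or.inl (by linarith)), Real.zero_rpow (by linarith),
            Real.rpow_add hy, Real.rpow_one]
          have : 1 - γ ≠ 0 := by linarith
          rw [neg_add_eq_sub]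
          apply le_of_eq
          field_simp
          ring
  · have hi := integrableOn_Ioi_rpow_of_lt (show -γ - 1 < -1 by linarith) hy
    calc ∫⁻ u in Ioi y, ENNReal.ofReal (u ^ (-γ) / max u y)
        = ∫⁻ u in Ioi y, ENNReal.ofReal (u ^ (-γ - 1)) := by
          refine setLIntegral_congr_fun measurableSet_Ioi fun u hu => ?_
          have hu' : y < u := hu
          rw [max_eq_left hu'.le, Real.rpow_sub (hy.trans hu'), Real.rpow_one]
      _ = ENNReal.ofReal (∫ u in Ioi y, u ^ (-γ - 1)) := by
          rw [ofReal_integral_eq_lintegral_ofReal hi]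
          filter_upwards [ae_restrict_mem measurableSet_Ioi] with u hu
          have : 0 < u := hy.trans hu
          positivity
      _ ≤ _ := by
          apply ENNReal.ofReal_le_ofReal
          rw [integral_Ioi_rpow_of_lt (by linarith) hy]
          apply le_of_eq
          rw [sub_add_cancel]
          field_simp

/-- The constant of the Forelli–Rudin estimate. -/
noncomputable def forelliRudinConst (γ : ℝ) : ℝ := 2 * Real.pi * (1 / (1 - γ) + 1 / γ)

theorem forelliRudinConst_pos {γ : ℝ} (h0 : 0 < γ) (h1 : γ < 1) : 0 < forelliRudinConst γ := by
  have : 0 < 1 - γ := by linarith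
  unfold forelliRudinConst
  positivity

/-- A Forelli–Rudin estimate. -/
theorem lintegral_disk_rpow_div_le {γ : ℝ} (h0 : 0 < γ) (h1 : γ < 1) {z : ℂ} (hz : ‖z‖ < 1) :
    ∫⁻ w in disk, ENNReal.ofReal ((1 - ‖w‖) ^ (-γ) * (‖1 - conj w * z‖ ^ 2)⁻¹) ≤
      ENNReal.ofReal (forelliRudinConst γ * (1 - ‖z‖) ^ (-γ)) := by
  have hab : ∀ w : ℂ, ‖w‖ < 1 → (1 - ‖w‖) ^ (-γ) = |1 - ‖w‖| ^ (-γ) := fun w hw => by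
    rw [abs_of_pos (by linarith)]
  have e1 : ∫⁻ w in disk, ENNReal.ofReal ((1 - ‖w‖) ^ (-γ) * (‖1 - conj w * z‖ ^ 2)⁻¹) =
      ∫⁻ w in ball 0 1, ENNReal.ofReal (|1 - ‖w‖| ^ (-γ) * (‖1 - conj w * z‖ ^ 2)⁻¹) := by
    refine setLIntegral_congr_fun measurableSet_ball fun w hw => ?_
    rw [hab w (mem_disk_iff.1 hw)]
  have hcont : ContinuousOn (fun w : ℂ => |1 - ‖w‖| ^ (-γ) * (‖1 - conj w * z‖ ^ 2)⁻¹)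
      (ball 0 1) := by
    refine ContinuousOn.mul ?_ ?_
    · refine ContinuousOn.rpow_const (by fun_prop) fun w hw => Or.inl ?_
      have : ‖w‖ < 1 := mem_disk_iff.1 hw
      rw [abs_of_pos] <;> linarith
    · refine ContinuousOn.inv₀ (by fun_prop) fun w hw => ?_
      exact pow_ne_zero 2 (norm_one_sub_conj_mul_pos (mem_disk_iff.1 hw) hz).ne'
  rw [e1, lintegral_ball_eq_lintegral_circleAverage (fun w => by positivity) hcont]
  set y := 1 - ‖z‖ with hy
  have hy0 : 0 < y := by linarith
  have hy1 : y ≤ 1 := by linarith [norm_nonneg z]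
  calc _ ≤ ∫⁻ r in Ioo 0 1, ENNReal.ofReal (2 * Real.pi) *
        ENNReal.ofReal ((1 - r) ^ (-γ) / max (1 - r) y) := by
        refine setLIntegral_mono' measurableSet_Ioo fun r hr => ?_
        rw [← ENNReal.ofReal_mul (by positivity)]
        apply ENNReal.ofReal_le_ofReal
        have hr0 : 0 < r := hr.1
        have hr1 : r < 1 := hr.2
        have hr2 : 0 < 1 - r := by linarith
        have e2 : Real.circleAverage (fun w : ℂ => |1 - ‖w‖| ^ (-γ) *
            (‖1 - conj w * z‖ ^ 2)⁻¹) 0 r = (1 - r) ^ (-γ) * (1 - r ^ 2 * ‖z‖ ^ 2)⁻¹ := by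
          rw [← circleAverage_inv_norm_sq hr0 hr1 hz, ← smul_eq_mul, ← Real.circleAverage_fun_smul]
          refine Real.circleAverage_congr_sphere fun w hw => ?_
          rw [abs_of_pos hr0, mem_sphere_zero_iff_norm] at hw
          rw [hw, abs_of_pos hr2, smul_eq_mul]
        rw [e2, mul_assoc]
        refine mul_le_mul_of_nonneg_left ?_ (by positivity)
        -- Here (r|z|)² ≤ r|z| ≤ min(r, |z|).
        have hm : max (1 - r) y ≤ 1 - r ^ 2 * ‖z‖ ^ 2 := by
          have hzn := norm_nonneg z
          have h2 : r * ‖z‖ ≤ r := by nlinarith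
          have h3 : r * ‖z‖ ≤ ‖z‖ := by nlinarith
          have h4 : (r * ‖z‖) ^ 2 ≤ r * ‖z‖ := by nlinarith [mul_nonneg hr0.le hzn]
          rw [← mul_pow]
          refine max_le ?_ ?_ <;> linarith
        have hm0 : 0 < max (1 - r) y := lt_max_of_lt_right hy0
        calc r * ((1 - r) ^ (-γ) * (1 - r ^ 2 * ‖z‖ ^ 2)⁻¹)
            ≤ 1 * ((1 - r) ^ (-γ) * (max (1 - r) y)⁻¹) :=
              mul_le_mul hr1.le
                (mul_le_mul_of_nonneg_left (inv_anti₀ hm0 hm) (Real.rpow_nonneg hr2.le _))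
                (mul_nonneg (Real.rpow_nonneg hr2.le _) (inv_nonneg.2 (hm0.le.trans hm)))
                zero_le_one
          _ = _ := by rw [one_mul, div_eq_mul_inv]
    _ ≤ ENNReal.ofReal (2 * Real.pi) *
        ∫⁻ u in Ioi 0, ENNReal.ofReal (u ^ (-γ) / max u y) := by
        rw [lintegral_const_mul' _ _ ENNReal.ofReal_ne_top]
        refine mul_le_mul_right ?_ _
        rw [← lintegral_indicator measurableSet_Ioo, ← lintegral_indicator measurableSet_Ioi,
          ← lintegral_sub_left_eq_self _ (1 : ℝ)]
        refine lintegral_mono fun r => ?_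
        by_cases hr : 1 - r ∈ Ioo (0 : ℝ) 1
        · rw [indicator_of_mem hr, indicator_of_mem (show r ∈ Ioi (0 : ℝ) by
            have := hr.2; simp only [mem_Ioi]; linarith)]
          simp
        · rw [indicator_of_notMem hr]; exact zero_le
    _ ≤ _ := by
        refine (mul_le_mul_right (lintegral_rpow_div_max_le h0 h1 hy0) _).trans_eq ?_
        rw [← ENNReal.ofReal_mul (by positivity), forelliRudinConst, ← mul_assoc]

/-! ### Discrete Forelli–Rudin sums and bounded overlap. -/

theorem half_rpow_neg_le {γ x y : ℝ} (h0 : 0 ≤ γ) (h1 : γ ≤ 1) (hx : 0 < x)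
    (hy : 0 < y) (hxy : y ≤ 2 * x) : x ^ (-γ) / 2 ≤ y ^ (-γ) := by
  have h2 : (2 : ℝ) ^ γ ≤ 2 := by
    simpa using Real.rpow_le_rpow_of_exponent_le one_le_two h1
  calc x ^ (-γ) / 2 ≤ x ^ (-γ) / 2 ^ γ := by gcongr
    _ = (2 * x) ^ (-γ) := by
        rw [Real.mul_rpow zero_le_two hx.le, Real.rpow_neg zero_le_two, div_eq_inv_mul]
    _ ≤ y ^ (-γ) := Real.rpow_le_rpow_of_nonpos hy hxy (by linarith)

namespace Separated
variable {s : ℝ} {b : ℕ → ℂ}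

/-- The discrete form of the Forelli–Rudin estimate. -/
theorem tsum_forelliRudin_le (h : Separated s b) (hs0 : 0 < s) (hs : s ≤ 1) {γ : ℝ} (h0 : 0 < γ)
    (h1 : γ < 1) {z : ℂ} (hz : ‖z‖ < 1) :
    ∑' k, ENNReal.ofReal ((1 - ‖b k‖) ^ (2 - γ) * (‖1 - conj (b k) * z‖ ^ 2)⁻¹) ≤
      ENNReal.ofReal (8 * forelliRudinConst γ / s ^ 2 * (1 - ‖z‖) ^ (-γ)) := by
  -- The factors 1/2 and 4/9 = (2/3)² pay for moving from b_k to w with |w - b_k| < (1 - |b_k|)/2: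
  -- there 1 - |w| ≤ 2(1 - |b_k|), and |1 - w̄z| grows by at most 3/2.
  set G : ℕ → ℝ≥0∞ := fun k =>
    ENNReal.ofReal ((1 - ‖b k‖) ^ (-γ) / 2 * (4 / 9 * (‖1 - conj (b k) * z‖ ^ 2)⁻¹)) with hG
  have key := h.tsum_volume_ball_mul_le hs (G := G)
    (g := fun w => ENNReal.ofReal ((1 - ‖w‖) ^ (-γ) * (‖1 - conj w * z‖ ^ 2)⁻¹)) ?_
  · have e : ∀ k, ENNReal.ofReal ((1 - ‖b k‖) ^ (2 - γ) * (‖1 - conj (b k) * z‖ ^ 2)⁻¹) ≤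
        ENNReal.ofReal (8 / s ^ 2) * (volume (ball (b k) (s / 2 * (1 - ‖b k‖))) * G k) := by
      intro k
      have hd : 0 < 1 - ‖b k‖ := by linarith [h.norm_lt_one k]
      have hp := norm_one_sub_conj_mul_pos (h.norm_lt_one k) hz
      rw [h.volume_ball hs0.le, hG, ← ENNReal.ofReal_mul (by positivity),
        ← ENNReal.ofReal_mul (by positivity)]
      apply ENNReal.ofReal_le_ofReal
      have e1 : (1 - ‖b k‖) ^ (2 - γ) = (1 - ‖b k‖) ^ 2 * (1 - ‖b k‖) ^ (-γ) := by
        rw [← Real.rpow_natCast, ← Real.rpow_add hd]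
        norm_num [sub_eq_add_neg]
      rw [e1]
      have e2 : 8 / s ^ 2 * (Real.pi * s ^ 2 / 4 * (1 - ‖b k‖) ^ 2 *
          ((1 - ‖b k‖) ^ (-γ) / 2 * (4 / 9 * (‖1 - conj (b k) * z‖ ^ 2)⁻¹))) =
          (4 * Real.pi / 9) * ((1 - ‖b k‖) ^ 2 * (1 - ‖b k‖) ^ (-γ) *
            (‖1 - conj (b k) * z‖ ^ 2)⁻¹) := by
        field_simp
        norm_num
      rw [e2]
      refine le_mul_of_one_le_left (by positivity) ?_
      linarith [Real.pi_gt_three]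
    refine (ENNReal.tsum_le_tsum e).trans ?_
    rw [ENNReal.tsum_mul_left]
    refine (mul_le_mul_right (key.trans (lintegral_disk_rpow_div_le h0 h1 hz)) _).trans_eq ?_
    rw [← ENNReal.ofReal_mul (by positivity)]
    congr 1
    ring
  · intro k w hw
    have hd : 0 < 1 - ‖b k‖ := by linarith [h.norm_lt_one k]
    have hwd : ‖w‖ < 1 := mem_disk_iff.1 (h.ball_subset_disk hs k hw)
    rw [mem_ball, dist_eq_norm] at hw
    have hw' : ‖w - b k‖ < (1 - ‖b k‖) / 2 := by nlinarith
    have hbw : ‖b k‖ ≤ ‖w‖ + ‖w - b k‖ := by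
      have := norm_sub_le w (w - b k)
      simpa using this
    refine ENNReal.ofReal_le_ofReal (mul_le_mul ?_ ?_ (by positivity)
      (Real.rpow_nonneg (by linarith) _))
    · exact half_rpow_neg_le h0.le h1.le hd (by linarith) (by linarith)
    · have hp := norm_one_sub_conj_mul_pos hwd hz
      have hle := one_sub_norm_le_left (w := b k) hz
      have h2 : ‖1 - conj w * z‖ ≤ 3 / 2 * ‖1 - conj (b k) * z‖ := by
        have e : 1 - conj w * z = (1 - conj (b k) * z) - conj (w - b k) * z := by
          simp only [map_sub]; ring
        have h3 : ‖conj (w - b k) * z‖ ≤ ‖w - b k‖ := by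
          rw [norm_mul, Complex.norm_conj]
          exact mul_le_of_le_one_right (norm_nonneg _) hz.le
        rw [e]
        refine (norm_sub_le _ _).trans ?_
        linarith
      calc 4 / 9 * (‖1 - conj (b k) * z‖ ^ 2)⁻¹ = ((3 / 2 * ‖1 - conj (b k) * z‖) ^ 2)⁻¹ := by
            rw [mul_pow, mul_inv]; norm_num
        _ ≤ (‖1 - conj w * z‖ ^ 2)⁻¹ := by gcongr

/-- A point of the disk lies in boundedly many of the disks of radius `(1 - |b_k|) / 2`. -/
theorem tsum_indicator_ball_le (h : Separated s b) (hs0 : 0 < s) (hs : s ≤ 1) (z : ℂ) :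
    ∑' k, (ball (b k) ((1 - ‖b k‖) / 2)).indicator (fun _ => (1 : ℝ≥0∞)) z ≤
      ENNReal.ofReal (36 / s ^ 2) := by
  by_cases hz : ‖z‖ < 1
  swap
  · refine (ENNReal.tsum_eq_zero.2 fun k => indicator_of_notMem (fun hk => hz ?_) _).trans_le
      zero_le
    rw [mem_ball, dist_eq_norm] at hk
    have : ‖z‖ ≤ ‖z - b k‖ + ‖b k‖ := by simpa using norm_add_le (z - b k) (b k)
    linarith [h.norm_lt_one k]
  set δ := 1 - ‖z‖ with hδ
  have hδ0 : 0 < δ := by linarith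
  -- If z lies in the k-th disk, then 1 - |b_k| lies between 2δ/3 and 2δ. The disjoint separation
  -- disks of all such k fit in `ball z (2 * δ)`, each with area at least πs²δ²/9; comparing areas
  -- gives 36/s².
  have key := h.tsum_volume_ball_mul_le hs
    (G := fun k => (ball (b k) ((1 - ‖b k‖) / 2)).indicator (fun _ => (1 : ℝ≥0∞)) z)
    (g := (ball z (2 * δ)).indicator fun _ => 1) ?_
  · have h1 : ∀ k, (ball (b k) ((1 - ‖b k‖) / 2)).indicator (fun _ => (1 : ℝ≥0∞)) z ≤
        ENNReal.ofReal (9 / (Real.pi * s ^ 2 * δ ^ 2)) *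
        (volume (ball (b k) (s / 2 * (1 - ‖b k‖))) *
          (ball (b k) ((1 - ‖b k‖) / 2)).indicator (fun _ => (1 : ℝ≥0∞)) z) := by
      intro k
      by_cases hk : z ∈ ball (b k) ((1 - ‖b k‖) / 2)
      swap
      · rw [indicator_of_notMem hk]; exact zero_le
      rw [indicator_of_mem hk, mul_one, h.volume_ball hs0.le,
        ← ENNReal.ofReal_mul (by positivity), ← ENNReal.ofReal_one]
      apply ENNReal.ofReal_le_ofReal
      rw [mem_ball, dist_eq_norm] at hk
      have h2 : ‖b k‖ ≤ ‖z‖ + ‖z - b k‖ := by simpa using norm_sub_le z (z - b k)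
      have h3 : δ ≤ 3 / 2 * (1 - ‖b k‖) := by
        have : ‖b k‖ - ‖z‖ ≤ ‖z - b k‖ := by linarith
        linarith
      have h4 : δ ^ 2 ≤ (3 / 2 * (1 - ‖b k‖)) ^ 2 := by gcongr
      have e : 9 / (Real.pi * s ^ 2 * δ ^ 2) * (Real.pi * s ^ 2 / 4 * (1 - ‖b k‖) ^ 2) =
          (3 / 2 * (1 - ‖b k‖)) ^ 2 / δ ^ 2 := by
        field_simp
        ring
      rw [e, one_le_div (by positivity)]
      exact h4
    refine (ENNReal.tsum_le_tsum h1).trans ?_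
    rw [ENNReal.tsum_mul_left]
    have h5 : ∫⁻ w in disk, (ball z (2 * δ)).indicator (fun _ => (1 : ℝ≥0∞)) w ≤
        ENNReal.ofReal (4 * Real.pi * δ ^ 2) := by
      refine (setLIntegral_le_lintegral _ _).trans ?_
      rw [lintegral_indicator measurableSet_ball, setLIntegral_one, Complex.volume_ball,
        ← ENNReal.ofReal_pow (by positivity), ← NNReal.coe_real_pi, ← ENNReal.ofReal_coe_nnreal,
        ← ENNReal.ofReal_mul (by positivity)]
      apply ENNReal.ofReal_le_ofReal
      apply le_of_eq
      ring
    refine (mul_le_mul_right (key.trans h5) _).trans_eq ?_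
    rw [← ENNReal.ofReal_mul (by positivity)]
    congr 1
    field_simp
    norm_num
  · intro k w hw
    by_cases hk : z ∈ ball (b k) ((1 - ‖b k‖) / 2)
    swap
    · simp only [indicator_of_notMem hk]; exact zero_le
    have hd : 0 < 1 - ‖b k‖ := by linarith [h.norm_lt_one k]
    rw [mem_ball, dist_eq_norm] at hw
    have hk' := hk
    rw [mem_ball, dist_eq_norm] at hk'
    have hzn : ‖z‖ ≤ ‖z - b k‖ + ‖b k‖ := by simpa using norm_add_le (z - b k) (b k)
    have hwz : ‖w - z‖ ≤ ‖w - b k‖ + ‖z - b k‖ := by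
      simpa using norm_sub_le (w - b k) (z - b k)
    have hw' : ‖w - b k‖ < (1 - ‖b k‖) / 2 := by nlinarith
    have : w ∈ ball z (2 * δ) := by
      rw [mem_ball, dist_eq_norm]
      linarith
    rw [indicator_of_mem this, indicator_of_mem hk]

theorem tsum_setLIntegral_ball_le (h : Separated s b) (hs0 : 0 < s) (hs : s ≤ 1) {g : ℂ → ℝ≥0∞}
    (hg : AEMeasurable g (volume.restrict disk)) :
    ∑' k, ∫⁻ z in ball (b k) ((1 - ‖b k‖) / 2), g z ≤
      ENNReal.ofReal (36 / s ^ 2) * ∫⁻ z in disk, g z := by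
  have hsub : ∀ k, ball (b k) ((1 - ‖b k‖) / 2) ⊆ disk := by
    intro k w hw
    rw [mem_ball, dist_eq_norm] at hw
    rw [mem_disk_iff]
    have : ‖w‖ ≤ ‖w - b k‖ + ‖b k‖ := by simpa using norm_add_le (w - b k) (b k)
    linarith [h.norm_lt_one k]
  calc ∑' k, ∫⁻ z in ball (b k) ((1 - ‖b k‖) / 2), g z
      = ∑' k, ∫⁻ z in disk, (ball (b k) ((1 - ‖b k‖) / 2)).indicator g z := by
        refine tsum_congr fun k => ?_
        rw [setLIntegral_indicator measurableSet_ball, inter_eq_left.2 (hsub k)]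
    _ = ∫⁻ z in disk, ∑' k, (ball (b k) ((1 - ‖b k‖) / 2)).indicator g z :=
        (lintegral_tsum fun k => hg.indicator measurableSet_ball).symm
    _ ≤ ∫⁻ z in disk, ENNReal.ofReal (36 / s ^ 2) * g z := by
        refine lintegral_mono fun z => ?_
        have e : ∀ k, (ball (b k) ((1 - ‖b k‖) / 2)).indicator g z =
            (ball (b k) ((1 - ‖b k‖) / 2)).indicator (fun _ => (1 : ℝ≥0∞)) z * g z := by
          intro k
          by_cases hk : z ∈ ball (b k) ((1 - ‖b k‖) / 2) <;> simp [hk]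
        simp only [e, ENNReal.tsum_mul_right]
        exact mul_le_mul_left (h.tsum_indicator_ball_le hs0 hs z) _
    _ = _ := lintegral_const_mul' _ _ ENNReal.ofReal_ne_top

end Separated

/-! ### Small R: local oscillation and the reverse Carleson inequality. -/

/-- The oscillation of a holomorphic function near the centre of a disk is controlled by its
square integral. -/
theorem enorm_sub_sq_le {f : ℂ → ℂ} {c z : ℂ} {d t : ℝ} (hd : 0 < d)
    (ht1 : t ≤ 1 / 16) (hf : DifferentiableOn ℂ f (ball c (d / 2)))
    (hJ : ∫⁻ w in ball c (d / 2), ‖f w‖ₑ ^ 2 ≠ ∞) (hz : ‖z - c‖ < 4 * t * d) :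
    ‖f z - f c‖ₑ ^ 2 ≤ ENNReal.ofReal (2 ^ 14 * t ^ 2 / (Real.pi * d ^ 2)) *
      ∫⁻ w in ball c (d / 2), ‖f w‖ₑ ^ 2 := by
  set J := (∫⁻ w in ball c (d / 2), ‖f w‖ₑ ^ 2).toReal with hJdef
  have hJ0 : 0 ≤ J := ENNReal.toReal_nonneg
  have hJe : ∫⁻ w in ball c (d / 2), ‖f w‖ₑ ^ 2 = ENNReal.ofReal J :=
    (ENNReal.ofReal_toReal hJ).symm
  have hpt : ∀ ζ ∈ ball c (d / 4), ‖f ζ‖ ^ 2 ≤ 16 / (Real.pi * d ^ 2) * J := by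
    intro ζ hζ
    have hsub : ball ζ (d / 4) ⊆ ball c (d / 2) := by
      refine ball_subset_ball' ?_
      have := (mem_ball.1 hζ).le
      linarith
    have h1 := (volume_ball_mul_sq_le (hf.mono hsub)).trans
      (lintegral_mono_set (f := fun w => ‖f w‖ₑ ^ 2) hsub)
    rw [hJe, Complex.volume_ball, ← ofReal_norm, ← ENNReal.ofReal_pow (norm_nonneg _),
      ← ENNReal.ofReal_pow (by positivity), ← ENNReal.ofReal_coe_nnreal,
      ← ENNReal.ofReal_mul (by positivity), ← ENNReal.ofReal_mul (by positivity),
      ENNReal.ofReal_le_ofReal_iff hJ0, NNReal.coe_real_pi] at h1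
    rw [div_mul_eq_mul_div, le_div_iff₀ (by positivity)]
    linarith
  set M := Real.sqrt (16 / (Real.pi * d ^ 2) * J) with hM
  have hpt' : ∀ ζ ∈ ball c (d / 4), ‖f ζ‖ ≤ M := fun ζ hζ => Real.le_sqrt_of_sq_le (hpt ζ hζ)
  have hmaps : MapsTo f (ball c (d / 4)) (closedBall (f c) (2 * M)) := by
    intro ζ hζ
    rw [mem_closedBall, dist_eq_norm]
    refine (norm_sub_le _ _).trans ?_
    linarith [hpt' ζ hζ, hpt' c (mem_ball_self (by positivity))]
  have hM0 : 0 ≤ M := Real.sqrt_nonneg _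
  have hlt : ‖z - c‖ < d / 4 := hz.trans_le (by nlinarith)
  -- Schwarz lemma from radius d/4 into radius 2M gives slope 8M/d, used at distance less than 4td.
  have key : ‖f z - f c‖ ≤ 32 * t * M := by
    have := Complex.dist_le_div_mul_dist_of_mapsTo_ball
      (hf.mono (ball_subset_ball (by linarith))) hmaps (by rwa [mem_ball, dist_eq_norm])
    rw [dist_eq_norm, dist_eq_norm] at this
    calc ‖f z - f c‖ ≤ 2 * M / (d / 4) * ‖z - c‖ := this
      _ ≤ 2 * M / (d / 4) * (4 * t * d) := by gcongr
      _ = 32 * t * M := by field_simp; ring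
  rw [hJe, ← ofReal_norm, ← ENNReal.ofReal_pow (norm_nonneg _),
    ← ENNReal.ofReal_mul (by positivity)]
  apply ENNReal.ofReal_le_ofReal
  calc ‖f z - f c‖ ^ 2 ≤ (32 * t * M) ^ 2 := by gcongr
    _ = 1024 * t ^ 2 * (16 / (Real.pi * d ^ 2) * J) := by
        rw [mul_pow, hM, Real.sq_sqrt (by positivity)]; ring
    _ = _ := by ring

theorem enorm_sq_le_two_mul (a b : ℂ) : ‖a‖ₑ ^ 2 ≤ 2 * ‖b‖ₑ ^ 2 + 2 * ‖a - b‖ₑ ^ 2 := by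
  simp only [← ofReal_norm, ← ENNReal.ofReal_pow (norm_nonneg _)]
  rw [← ENNReal.ofReal_ofNat 2, ← ENNReal.ofReal_mul zero_le_two,
    ← ENNReal.ofReal_mul zero_le_two, ← ENNReal.ofReal_add (by positivity) (by positivity)]
  apply ENNReal.ofReal_le_ofReal
  have h : ‖a‖ ≤ ‖b‖ + ‖a - b‖ := by simpa using norm_add_le b (a - b)
  nlinarith [norm_nonneg a, sq_nonneg (‖b‖ - ‖a - b‖), norm_nonneg b, norm_nonneg (a - b)]

theorem setLIntegral_area (g : ℂ → ℝ≥0∞) :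
    ∫⁻ z in disk, g z ∂area = ENNReal.ofReal Real.pi⁻¹ * ∫⁻ z in disk, g z := by
  rw [area, Measure.restrict_smul, lintegral_smul_measure,
    Measure.restrict_restrict measurableSet_disk, inter_self, smul_eq_mul]

theorem MemBergman.lintegral_ne_top {f : ℂ → ℂ} (hf : MemBergman f) :
    ∫⁻ z in disk, ‖f z‖ₑ ^ 2 ≠ ∞ := by
  have h := lintegral_rpow_enorm_lt_top_of_eLpNorm_lt_top two_ne_zero ENNReal.ofNat_ne_top hf.2.2
  rw [area, lintegral_smul_measure, smul_eq_mul] at h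
  intro htop
  have e : ∫⁻ z in disk, ‖f z‖ₑ ^ (2 : ℝ≥0∞).toReal = ∞ := by
    rw [← htop]; simp
  rw [e, ENNReal.mul_top] at h
  · exact h.ne rfl
  · simpa using Real.pi_pos

theorem MemBergman.aemeasurable_enorm_sq {f : ℂ → ℂ} (hf : MemBergman f) :
    AEMeasurable (fun z => ‖f z‖ₑ ^ 2) (volume.restrict disk) :=
  (hf.1.continuousOn.enorm.aemeasurable measurableSet_disk).pow_const 2

/-- From 1 - b̄z = (1 - |b|²) + b̄(b - z) one gets |b - z| < tanh R · (2(1 - |b|) + |b - z|), and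
tanh R ≤ 1/2 absorbs the last term. -/
theorem IsLattice.exists_mem_ball {R : ℝ} {b : ℕ → ℂ} (h : IsLattice R b) (hR : 0 < R)
    (ht : Real.tanh R ≤ 1 / 2) {z : ℂ} (hz : ‖z‖ < 1) :
    ∃ k, z ∈ ball (b k) (4 * Real.tanh R * (1 - ‖b k‖)) := by
  obtain ⟨k, hk⟩ := h.exists_norm_sub_lt hz
  refine ⟨k, ?_⟩
  have ht0 := tanh_pos hR
  have hb := h.norm_lt_one k
  have hb0 := norm_nonneg (b k)
  have e : 1 - conj (b k) * z = (1 - conj (b k) * b k) + conj (b k) * (b k - z) := by ring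
  have h1 : ‖1 - conj (b k) * b k‖ ≤ 2 * (1 - ‖b k‖) := by
    rw [← Complex.normSq_eq_conj_mul_self, ← Complex.sq_norm, ← Complex.ofReal_one,
      ← Complex.ofReal_sub, Complex.norm_real, Real.norm_of_nonneg (by nlinarith)]
    nlinarith
  have h2 : ‖conj (b k) * (b k - z)‖ ≤ ‖b k - z‖ := by
    rw [norm_mul, Complex.norm_conj]
    exact mul_le_of_le_one_left (norm_nonneg _) hb.le
  have h3 : ‖1 - conj (b k) * z‖ ≤ 2 * (1 - ‖b k‖) + ‖b k - z‖ := by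
    rw [e]
    exact (norm_add_le _ _).trans (add_le_add h1 h2)
  rw [mem_ball, dist_eq_norm, norm_sub_rev]
  have h4 : ‖b k - z‖ < Real.tanh R * (2 * (1 - ‖b k‖) + ‖b k - z‖) :=
    hk.trans_le (mul_le_mul_of_nonneg_left h3 ht0.le)
  nlinarith [norm_nonneg (b k - z)]

theorem isReverseCarleson_of_tanh_le {R : ℝ} {b : ℕ → ℂ} (hR : 0 < R) (h : IsLattice R b)
    (ht : Real.tanh R ≤ 1 / 2 ^ 14) : IsReverseCarleson (pointMeasure b) := by
  set t := Real.tanh R with htdef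
  have ht0 : 0 < t := tanh_pos hR
  have hsep : Separated (t / 2) b := h.toSeparated (by positivity) (by
    linarith [tanh_le_two_mul_tanh_half hR])
  have ht' : t ≤ 1 / 16 := ht.trans (by norm_num)
  -- The constant comes from I/2 ≤ 32πt²S, proved below, and the factor π⁻¹ in the area measure.
  refine ⟨1 / (64 * t ^ 2), by positivity, fun f hf => ?_⟩
  rw [setLIntegral_area, setLIntegral_pointMeasure h.mem_disk]
  set I := ∫⁻ z in disk, ‖f z‖ₑ ^ 2 with hI
  set S := ∑' k, ENNReal.ofReal ((1 - ‖b k‖) ^ 2) * ‖f (b k)‖ₑ ^ 2 with hS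
  have hItop : I ≠ ∞ := hf.lintegral_ne_top
  have hSle : S ≤ ∑' k, ENNReal.ofReal ((1 - ‖b k‖ ^ 2) ^ 2) * ‖f (b k)‖ₑ ^ 2 := by
    refine ENNReal.tsum_le_tsum fun k => mul_le_mul_left (ENNReal.ofReal_le_ofReal ?_) _
    have hb := h.norm_lt_one k
    have hb0 := norm_nonneg (b k)
    have : 1 - ‖b k‖ ≤ 1 - ‖b k‖ ^ 2 := by nlinarith
    have h0 : 0 ≤ 1 - ‖b k‖ := by linarith
    gcongr
  set J : ℕ → ℝ≥0∞ := fun k => ∫⁻ z in ball (b k) ((1 - ‖b k‖) / 2), ‖f z‖ₑ ^ 2 with hJ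
  have hball : ∀ k, ball (b k) ((1 - ‖b k‖) / 2) ⊆ disk := by
    intro k w hw
    rw [mem_ball, dist_eq_norm] at hw
    rw [mem_disk_iff]
    have : ‖w‖ ≤ ‖w - b k‖ + ‖b k‖ := by simpa using norm_add_le (w - b k) (b k)
    linarith [h.norm_lt_one k]
  have hJI : ∑' k, J k ≤ ENNReal.ofReal (36 / (t / 2) ^ 2) * I :=
    hsep.tsum_setLIntegral_ball_le (by positivity) (by linarith) hf.aemeasurable_enorm_sq
  have hlocal : ∀ k, ∫⁻ z in ball (b k) (4 * t * (1 - ‖b k‖)), ‖f z‖ₑ ^ 2 ≤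
      ENNReal.ofReal (32 * Real.pi * t ^ 2) *
        (ENNReal.ofReal ((1 - ‖b k‖) ^ 2) * ‖f (b k)‖ₑ ^ 2) +
      ENNReal.ofReal (2 ^ 19 * t ^ 4) * J k := by
    intro k
    have hd : 0 < 1 - ‖b k‖ := by linarith [h.norm_lt_one k]
    have hJk : J k ≠ ∞ := ne_top_of_le_ne_top hItop (lintegral_mono_set (hball k))
    calc ∫⁻ z in ball (b k) (4 * t * (1 - ‖b k‖)), ‖f z‖ₑ ^ 2
        ≤ ∫⁻ z in ball (b k) (4 * t * (1 - ‖b k‖)), (2 * ‖f (b k)‖ₑ ^ 2 +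
            2 * (ENNReal.ofReal (2 ^ 14 * t ^ 2 / (Real.pi * (1 - ‖b k‖) ^ 2)) * J k)) := by
          refine setLIntegral_mono' measurableSet_ball fun z hz => ?_
          refine (enorm_sq_le_two_mul (f z) (f (b k))).trans ?_
          refine add_le_add le_rfl (mul_le_mul_right ?_ _)
          rw [mem_ball, dist_eq_norm] at hz
          exact enorm_sub_sq_le hd ht' (hf.1.mono (hball k)) hJk hz
      _ = ENNReal.ofReal (16 * Real.pi * t ^ 2 * (1 - ‖b k‖) ^ 2) * (2 * ‖f (b k)‖ₑ ^ 2 +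
            2 * (ENNReal.ofReal (2 ^ 14 * t ^ 2 / (Real.pi * (1 - ‖b k‖) ^ 2)) * J k)) := by
          rw [setLIntegral_const, mul_comm, Complex.volume_ball,
            ← ENNReal.ofReal_pow (by positivity), ← NNReal.coe_real_pi,
            ← ENNReal.ofReal_coe_nnreal, ← ENNReal.ofReal_mul (by positivity)]
          congr 2
          ring
      _ = _ := by
          rw [mul_add, ← ENNReal.ofReal_ofNat 2]
          simp only [← mul_assoc]
          rw [← ENNReal.ofReal_mul (by positivity), ← ENNReal.ofReal_mul (by positivity),
            ← ENNReal.ofReal_mul (by positivity)]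
          congr 3
          · ring
          · field_simp
            norm_num
  have hmain : I ≤ ENNReal.ofReal (32 * Real.pi * t ^ 2) * S + ENNReal.ofReal (1 / 2) * I := by
    have hcov : disk ⊆ ⋃ k, ball (b k) (4 * t * (1 - ‖b k‖)) := fun z hz =>
      mem_iUnion.2 (h.exists_mem_ball hR (by linarith) (mem_disk_iff.1 hz))
    calc I ≤ ∫⁻ z in ⋃ k, ball (b k) (4 * t * (1 - ‖b k‖)), ‖f z‖ₑ ^ 2 := lintegral_mono_set hcov
      _ ≤ ∑' k, ∫⁻ z in ball (b k) (4 * t * (1 - ‖b k‖)), ‖f z‖ₑ ^ 2 := lintegral_iUnion_le _ _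
      _ ≤ ENNReal.ofReal (32 * Real.pi * t ^ 2) * S +
          ENNReal.ofReal (2 ^ 19 * t ^ 4) * ∑' k, J k := by
          refine (ENNReal.tsum_le_tsum hlocal).trans_eq ?_
          rw [ENNReal.tsum_add, ENNReal.tsum_mul_left, ENNReal.tsum_mul_left]
      _ ≤ _ := by
          refine add_le_add le_rfl ((mul_le_mul_right hJI _).trans ?_)
          rw [← mul_assoc, ← ENNReal.ofReal_mul (by positivity)]
          refine mul_le_mul_left (ENNReal.ofReal_le_ofReal ?_) _
          -- Local error t⁴ times overlap t⁻² leaves 2¹⁹·144·t², below 1/2 since t ≤ 2⁻¹⁴.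
          have e : 2 ^ 19 * t ^ 4 * (36 / (t / 2) ^ 2) = 2 ^ 19 * 144 * t ^ 2 := by
            field_simp
            norm_num
          rw [e]
          have : t ^ 2 ≤ (1 / 2 ^ 14) ^ 2 := by gcongr
          norm_num at this ⊢
          linarith
  have hfin : ENNReal.ofReal (1 / 2) * I ≤ ENNReal.ofReal (32 * Real.pi * t ^ 2) * S := by
    have h2 : ENNReal.ofReal (1 / 2) * I + ENNReal.ofReal (1 / 2) * I = I := by
      rw [← add_mul, ← ENNReal.ofReal_add (by norm_num) (by norm_num)]
      norm_num
    -- Cancelling I/2 requires I finite; membership of f in the Bergman space supplies this.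
    refine ENNReal.le_of_add_le_add_right (a := ENNReal.ofReal (1 / 2) * I)
      (ENNReal.mul_ne_top ENNReal.ofReal_ne_top hItop) ?_
    rw [h2]
    exact hmain
  refine le_trans ?_ hSle
  calc ENNReal.ofReal (1 / (64 * t ^ 2)) * (ENNReal.ofReal Real.pi⁻¹ * I)
      = ENNReal.ofReal (1 / (32 * Real.pi * t ^ 2)) * (ENNReal.ofReal (1 / 2) * I) := by
        rw [← mul_assoc, ← mul_assoc, ← ENNReal.ofReal_mul (by positivity),
          ← ENNReal.ofReal_mul (by positivity)]
        congr 2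
        field_simp
        norm_num
    _ ≤ ENNReal.ofReal (1 / (32 * Real.pi * t ^ 2)) *
        (ENNReal.ofReal (32 * Real.pi * t ^ 2) * S) := mul_le_mul_right hfin _
    _ = S := by
        rw [← mul_assoc, ← ENNReal.ofReal_mul (by positivity), one_div_mul_cancel (by positivity),
          ENNReal.ofReal_one, one_mul]

/-! ### Large R: infinite linear systems and kernel series. -/

theorem summable_and_tsum_le_of_tsum_ofReal_le {a : ℕ → ℝ} {C : ℝ} (ha : ∀ k, 0 ≤ a k)
    (hC : 0 ≤ C) (h : ∑' k, ENNReal.ofReal (a k) ≤ ENNReal.ofReal C) :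
    Summable a ∧ ∑' k, a k ≤ C := by
  have hs : Summable a := by
    have := ENNReal.summable_toReal (ne_top_of_le_ne_top ENNReal.ofReal_ne_top h)
    simpa only [ENNReal.toReal_ofReal (ha _)] using this
  refine ⟨hs, ?_⟩
  rwa [← ENNReal.ofReal_tsum_of_nonneg ha hs, ENNReal.ofReal_le_ofReal_iff hC] at h

/-- Diagonally dominant infinite systems have bounded solutions. -/
theorem exists_bounded_solution {B : ℕ → ℕ → ℂ} (hB : ∀ j, Summable fun k => ‖B j k‖)
    (hB' : ∀ j, ∑' k, ‖B j k‖ ≤ 1 / 2) (v : ℕ →ᵇ ℂ) :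
    ∃ e : ℕ →ᵇ ℂ, ∀ j, e j + ∑' k, B j k * e k = v j := by
  have hsum : ∀ (e : ℕ →ᵇ ℂ) j, Summable fun k => ‖B j k * e k‖ := fun e j => by
    refine ((hB j).mul_right ‖e‖).of_nonneg_of_le (fun k => norm_nonneg _) fun k => ?_
    rw [norm_mul]
    exact mul_le_mul_of_nonneg_left (e.norm_coe_le_norm k) (norm_nonneg _)
  have hbound : ∀ (e : ℕ →ᵇ ℂ) j, ‖∑' k, B j k * e k‖ ≤ 1 / 2 * ‖e‖ := fun e j => by
    refine (norm_tsum_le_tsum_norm (hsum e j)).trans ?_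
    calc ∑' k, ‖B j k * e k‖ ≤ ∑' k, ‖B j k‖ * ‖e‖ := by
          refine (hsum e j).tsum_le_tsum (fun k => ?_) ((hB j).mul_right _)
          rw [norm_mul]
          exact mul_le_mul_of_nonneg_left (e.norm_coe_le_norm k) (norm_nonneg _)
      _ = (∑' k, ‖B j k‖) * ‖e‖ := tsum_mul_right
      _ ≤ 1 / 2 * ‖e‖ := mul_le_mul_of_nonneg_right (hB' j) (norm_nonneg _)
  -- Solutions are the fixed points of e ↦ v - Be, a 1/2-contraction in the sup norm.
  let T : (ℕ →ᵇ ℂ) → (ℕ →ᵇ ℂ) := fun e =>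
    v - BoundedContinuousFunction.ofNormedAddCommGroupDiscrete (fun j => ∑' k, B j k * e k)
      (1 / 2 * ‖e‖) (hbound e)
  have hT : ∀ e j, T e j = v j - ∑' k, B j k * e k := fun e j => rfl
  have hcontr : ContractingWith (1 / 2) T := by
    refine ⟨by rw [← NNReal.coe_lt_coe]; norm_num, LipschitzWith.of_dist_le_mul fun e e' => ?_⟩
    have h2 : ((1 / 2 : NNReal) : ℝ) = 1 / 2 := by norm_num
    rw [h2, BoundedContinuousFunction.dist_le (by positivity)]
    intro j
    have h3 : T e j - T e' j = ∑' k, B j k * (e' - e) k := by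
      rw [hT, hT, sub_sub_sub_cancel_left,
        ← (hsum e' j).of_norm.tsum_sub (hsum e j).of_norm]
      simp [mul_sub]
    rw [dist_eq_norm, h3, dist_comm, dist_eq_norm]
    exact hbound _ _
  refine ⟨hcontr.fixedPoint T, fun j => ?_⟩
  have h4 := congrArg (fun e : ℕ →ᵇ ℂ => e j) hcontr.fixedPoint_isFixedPt
  simp only [hT] at h4
  rw [← h4]
  simp

/-- A power of the Bergman kernel, normalized to be `1` on the diagonal. -/
noncomputable def normKernel (b z : ℂ) : ℂ := ((1 - ‖b‖ ^ 2 : ℝ) / (1 - conj b * z)) ^ 3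

theorem normKernel_self {b : ℂ} (hb : ‖b‖ < 1) : normKernel b b = 1 := by
  have h := one_sub_conj_mul_ne_zero hb hb
  have e : ((1 - ‖b‖ ^ 2 : ℝ) : ℂ) = 1 - conj b * b := by
    rw [← Complex.normSq_eq_conj_mul_self, ← Complex.sq_norm]
    push_cast
    ring
  rw [normKernel, e, div_self h, one_pow]

theorem differentiableOn_normKernel {b : ℂ} (hb : ‖b‖ < 1) :
    DifferentiableOn ℂ (normKernel b) disk := by
  refine DifferentiableOn.pow (DifferentiableOn.div (by fun_prop) (by fun_prop) fun z hz => ?_) 3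
  exact one_sub_conj_mul_ne_zero hb (mem_disk_iff.1 hz)

theorem norm_normKernel_le {b z : ℂ} (hb : ‖b‖ < 1) :
    ‖normKernel b z‖ ≤ 8 * ((1 - ‖b‖) / ‖1 - conj b * z‖) ^ 3 := by
  have hb0 := norm_nonneg b
  rw [normKernel, norm_pow, norm_div, Complex.norm_real, Real.norm_of_nonneg (by nlinarith)]
  have h : 1 - ‖b‖ ^ 2 ≤ 2 * (1 - ‖b‖) := by nlinarith
  have h0 : 0 ≤ 1 - ‖b‖ ^ 2 := by nlinarith
  calc ((1 - ‖b‖ ^ 2) / ‖1 - conj b * z‖) ^ 3 ≤ (2 * (1 - ‖b‖) / ‖1 - conj b * z‖) ^ 3 := by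
        gcongr
    _ = _ := by rw [mul_div_assoc, mul_pow]; norm_num

/-- One of the three factors (1 - |b|)/|1 - b̄z| ≤ 1 is dropped, leaving the Forelli–Rudin summand
with γ = 1/4. -/
theorem rpow_neg_quarter_mul_norm_normKernel_le {b z : ℂ} (hb : ‖b‖ < 1) (hz : ‖z‖ < 1) :
    (1 - ‖b‖) ^ (-(1 / 4) : ℝ) * ‖normKernel b z‖ ≤
      8 * ((1 - ‖b‖) ^ (2 - 1 / 4 : ℝ) * (‖1 - conj b * z‖ ^ 2)⁻¹) := by
  have hd : 0 < 1 - ‖b‖ := by linarith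
  have hp := norm_one_sub_conj_mul_pos hb hz
  have hle := one_sub_norm_le_left (w := b) hz
  have hq : (1 - ‖b‖) / ‖1 - conj b * z‖ ≤ 1 := (div_le_one hp).2 hle
  have e : (1 - ‖b‖) ^ (2 - 1 / 4 : ℝ) = (1 - ‖b‖) ^ (-(1 / 4) : ℝ) * (1 - ‖b‖) ^ 2 := by
    rw [← Real.rpow_natCast, ← Real.rpow_add hd]
    norm_num
  calc (1 - ‖b‖) ^ (-(1 / 4) : ℝ) * ‖normKernel b z‖
      ≤ (1 - ‖b‖) ^ (-(1 / 4) : ℝ) * (8 * ((1 - ‖b‖) / ‖1 - conj b * z‖) ^ 2) := by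
        refine mul_le_mul_of_nonneg_left ((norm_normKernel_le hb).trans ?_) (by positivity)
        refine mul_le_mul_of_nonneg_left ?_ (by norm_num)
        exact pow_le_pow_of_le_one (by positivity) hq (by norm_num)
    _ = _ := by
        rw [e, div_pow]
        ring

/-- Used with d = 1 - |b_k|, e = 1 - |b_j|, D = |1 - b̄_k b_j|. The hypothesis is spent to the power
1/8, gaining η^(1/8), and d ≤ D to the power 3/4. What remains is the Forelli–Rudin summand for γ =
1/8, whose bound e^(-1/8) combines with the e^(-1/8) here into the weight e^(-1/4). -/
theorem offDiagonal_le {d e D η : ℝ} (hd : 0 < d) (he : 0 < e) (hD : 0 < D) (hη : 0 ≤ η)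
    (hdD : d ≤ D) (h : d * e ≤ η * D ^ 2) :
    d ^ (-(1 / 4) : ℝ) * (d / D) ^ 3 ≤
      η ^ (1 / 8 : ℝ) * e ^ (-(1 / 8) : ℝ) * (d ^ (2 - 1 / 8 : ℝ) * (D ^ 2)⁻¹) := by
  -- All exponents are multiples of 1/8, so in the eighth roots the inequality is between monomials.
  have root : ∀ x : ℝ, 0 ≤ x → (x ^ (1 / 8 : ℝ)) ^ 8 = x := fun x hx => by
    rw [← Real.rpow_mul_natCast hx]; norm_num
  have hde : d ^ (1 / 8 : ℝ) * e ^ (1 / 8 : ℝ) ≤ η ^ (1 / 8 : ℝ) * (D ^ (1 / 8 : ℝ)) ^ 2 := by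
    refine le_of_pow_le_pow_left₀ (n := 8) (by norm_num) (by positivity) ?_
    rw [mul_pow, mul_pow, root d hd.le, root e he.le, root η hη, ← pow_mul, mul_comm 2 8, pow_mul,
      root D hD.le]
    exact h
  have hdD' : d ^ (1 / 8 : ℝ) ≤ D ^ (1 / 8 : ℝ) := Real.rpow_le_rpow hd.le hdD (by norm_num)
  have e1 : d ^ (-(1 / 4) : ℝ) = ((d ^ (1 / 8 : ℝ)) ^ 2)⁻¹ := by
    rw [← Real.rpow_mul_natCast hd.le, ← Real.rpow_neg hd.le]; norm_num
  have e2 : e ^ (-(1 / 8) : ℝ) = (e ^ (1 / 8 : ℝ))⁻¹ := Real.rpow_neg he.le _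
  have e3 : d ^ (2 - 1 / 8 : ℝ) = (d ^ (1 / 8 : ℝ)) ^ 15 := by
    rw [← Real.rpow_mul_natCast hd.le]; norm_num
  rw [e1, e2, e3]
  have hd8 := root d hd.le
  have hD8 := root D hD.le
  have hα : 0 < d ^ (1 / 8 : ℝ) := by positivity
  have hβ : 0 < e ^ (1 / 8 : ℝ) := by positivity
  have hΔ : 0 < D ^ (1 / 8 : ℝ) := by positivity
  have hθ : 0 ≤ η ^ (1 / 8 : ℝ) := by positivity
  generalize d ^ (1 / 8 : ℝ) = α at *
  generalize e ^ (1 / 8 : ℝ) = β at *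
  generalize D ^ (1 / 8 : ℝ) = Δ at *
  generalize η ^ (1 / 8 : ℝ) = θ at *
  rw [← hd8, ← hD8]
  have key : α * β * α ^ 6 ≤ θ * Δ ^ 2 * Δ ^ 6 := by gcongr
  calc (α ^ 2)⁻¹ * (α ^ 8 / Δ ^ 8) ^ 3 = (α * β * α ^ 6) * (α ^ 15 / (β * Δ ^ 24)) := by
        field_simp
    _ ≤ (θ * Δ ^ 2 * Δ ^ 6) * (α ^ 15 / (β * Δ ^ 24)) := by gcongr
    _ = _ := by field_simp

namespace Separated
variable {b : ℕ → ℂ}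

/-- A Schur-test bound: the weight (1 - |·|)^(-1/4) is reproduced up to a constant, which controls
the growth of every `kernelSeries`. -/
theorem tsum_normKernel_le (h : Separated (1 / 2) b) {z : ℂ} (hz : ‖z‖ < 1) :
    (Summable fun k => (1 - ‖b k‖) ^ (-(1 / 4) : ℝ) * ‖normKernel (b k) z‖) ∧
    ∑' k, (1 - ‖b k‖) ^ (-(1 / 4) : ℝ) * ‖normKernel (b k) z‖ ≤
      256 * forelliRudinConst (1 / 4) * (1 - ‖z‖) ^ (-(1 / 4) : ℝ) := by
  have hd : ∀ k, 0 ≤ 1 - ‖b k‖ := fun k => by linarith [h.norm_lt_one k]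
  have hz0 : 0 ≤ 1 - ‖z‖ := by linarith
  have hF := forelliRudinConst_pos (γ := 1 / 4) (by norm_num) (by norm_num)
  refine summable_and_tsum_le_of_tsum_ofReal_le
    (fun k => mul_nonneg (Real.rpow_nonneg (hd k) _) (norm_nonneg _))
    (mul_nonneg (by positivity) (Real.rpow_nonneg hz0 _)) ?_
  have key := h.tsum_forelliRudin_le (by norm_num) (by norm_num) (γ := 1 / 4) (by norm_num)
    (by norm_num) hz
  calc _ ≤ ∑' k, ENNReal.ofReal 8 *
        ENNReal.ofReal ((1 - ‖b k‖) ^ (2 - 1 / 4 : ℝ) * (‖1 - conj (b k) * z‖ ^ 2)⁻¹) := by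
        refine ENNReal.tsum_le_tsum fun k => ?_
        rw [← ENNReal.ofReal_mul (by norm_num)]
        exact ENNReal.ofReal_le_ofReal
          (rpow_neg_quarter_mul_norm_normKernel_le (h.norm_lt_one k) hz)
    _ ≤ _ := by
        rw [ENNReal.tsum_mul_left]
        refine (mul_le_mul_right key _).trans_eq ?_
        rw [← ENNReal.ofReal_mul (by norm_num)]
        congr 1
        ring

theorem tsum_offDiagonal_le (h : Separated (1 / 2) b) {η : ℝ} (hη0 : 0 ≤ η)
    (hη : ∀ k j, k ≠ j → (1 - ‖b k‖) * (1 - ‖b j‖) ≤ η * ‖1 - conj (b k) * b j‖ ^ 2) (j : ℕ) :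
    ∑' k, (if k = j then 0 else (1 - ‖b k‖) ^ (-(1 / 4) : ℝ) * ‖normKernel (b k) (b j)‖) ≤
      256 * forelliRudinConst (1 / 8) * η ^ (1 / 8 : ℝ) * (1 - ‖b j‖) ^ (-(1 / 4) : ℝ) := by
  have hd : ∀ k, 0 < 1 - ‖b k‖ := fun k => by linarith [h.norm_lt_one k]
  have hF := forelliRudinConst_pos (γ := 1 / 8) (by norm_num) (by norm_num)
  have hw : ∀ k, 0 ≤ (1 - ‖b k‖) ^ (-(1 / 4) : ℝ) := fun k => Real.rpow_nonneg (hd k).le _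
  have hw' : 0 ≤ (1 - ‖b j‖) ^ (-(1 / 8) : ℝ) := Real.rpow_nonneg (hd j).le _
  refine (summable_and_tsum_le_of_tsum_ofReal_le (fun k => ?_)
    (mul_nonneg (by positivity) (hw j)) ?_).2
  · split_ifs
    · exact le_rfl
    · exact mul_nonneg (hw k) (norm_nonneg _)
  have key := h.tsum_forelliRudin_le (by norm_num) (by norm_num) (γ := 1 / 8) (by norm_num)
    (by norm_num) (h.norm_lt_one j)
  calc _ ≤ ∑' k, ENNReal.ofReal (8 * (η ^ (1 / 8 : ℝ) * (1 - ‖b j‖) ^ (-(1 / 8) : ℝ))) *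
        ENNReal.ofReal ((1 - ‖b k‖) ^ (2 - 1 / 8 : ℝ) * (‖1 - conj (b k) * b j‖ ^ 2)⁻¹) := by
        refine ENNReal.tsum_le_tsum fun k => ?_
        split_ifs with hkj
        · rw [ENNReal.ofReal_zero]; exact zero_le
        rw [← ENNReal.ofReal_mul (by positivity)]
        apply ENNReal.ofReal_le_ofReal
        have h1 := norm_normKernel_le (z := b j) (h.norm_lt_one k)
        have h2 := offDiagonal_le (hd k) (hd j)
          (norm_one_sub_conj_mul_pos (h.norm_lt_one k) (h.norm_lt_one j)) hη0
          (one_sub_norm_le_left (h.norm_lt_one j)) (hη k j hkj)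
        have h3 := mul_le_mul_of_nonneg_left h1 (hw k)
        linarith
    _ ≤ _ := by
        rw [ENNReal.tsum_mul_left]
        refine (mul_le_mul_right key _).trans_eq ?_
        rw [← ENNReal.ofReal_mul (by positivity)]
        congr 1
        have e : (1 - ‖b j‖) ^ (-(1 / 4) : ℝ) =
            (1 - ‖b j‖) ^ (-(1 / 8) : ℝ) * (1 - ‖b j‖) ^ (-(1 / 8) : ℝ) := by
          rw [← Real.rpow_add (hd j)]; norm_num
        rw [e]
        ring

end Separated

/-- The superposition of normalized kernels at `b` with weighted coefficients `e`. -/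
noncomputable def kernelSeries (b : ℕ → ℂ) (e : ℕ →ᵇ ℂ) (z : ℂ) : ℂ :=
  ∑' k, (((1 - ‖b k‖) ^ (-(1 / 4) : ℝ) : ℝ) : ℂ) * normKernel (b k) z * e k

namespace Separated
variable {b : ℕ → ℂ}

theorem norm_term_le (h : Separated (1 / 2) b) (e : ℕ →ᵇ ℂ) (k : ℕ) (z : ℂ) :
    ‖(((1 - ‖b k‖) ^ (-(1 / 4) : ℝ) : ℝ) : ℂ) * normKernel (b k) z * e k‖ ≤
      (1 - ‖b k‖) ^ (-(1 / 4) : ℝ) * ‖normKernel (b k) z‖ * ‖e‖ := by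
  have hd : 0 ≤ 1 - ‖b k‖ := by linarith [h.norm_lt_one k]
  rw [norm_mul, norm_mul, Complex.norm_real, Real.norm_of_nonneg (Real.rpow_nonneg hd _)]
  exact mul_le_mul_of_nonneg_left (e.norm_coe_le_norm k)
    (mul_nonneg (Real.rpow_nonneg hd _) (norm_nonneg _))

theorem summable_term (h : Separated (1 / 2) b) (e : ℕ →ᵇ ℂ) {z : ℂ} (hz : ‖z‖ < 1) :
    Summable fun k => ‖(((1 - ‖b k‖) ^ (-(1 / 4) : ℝ) : ℝ) : ℂ) * normKernel (b k) z * e k‖ :=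
  ((h.tsum_normKernel_le hz).1.mul_right ‖e‖).of_nonneg_of_le (fun _ => norm_nonneg _)
    fun k => h.norm_term_le e k z

theorem norm_kernelSeries_le (h : Separated (1 / 2) b) (e : ℕ →ᵇ ℂ) {z : ℂ} (hz : ‖z‖ < 1) :
    ‖kernelSeries b e z‖ ≤
      256 * forelliRudinConst (1 / 4) * (1 - ‖z‖) ^ (-(1 / 4) : ℝ) * ‖e‖ := by
  obtain ⟨hs, hle⟩ := h.tsum_normKernel_le hz
  calc ‖kernelSeries b e z‖ ≤ _ := norm_tsum_le_tsum_norm (h.summable_term e hz)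
    _ ≤ ∑' k, (1 - ‖b k‖) ^ (-(1 / 4) : ℝ) * ‖normKernel (b k) z‖ * ‖e‖ :=
        (h.summable_term e hz).tsum_le_tsum (fun k => h.norm_term_le e k z) (hs.mul_right _)
    _ ≤ _ := by
        rw [tsum_mul_right]
        exact mul_le_mul_of_nonneg_right hle (norm_nonneg _)

theorem differentiableOn_kernelSeries (h : Separated (1 / 2) b) (e : ℕ →ᵇ ℂ) :
    DifferentiableOn ℂ (kernelSeries b e) disk := by
  intro z hz
  obtain ⟨r, hzr, hr⟩ := exists_between (mem_disk_iff.1 hz)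
  have hr0 : 0 < 1 - r := by linarith
  have hsub : ball (0 : ℂ) r ⊆ disk := ball_subset_ball hr.le
  have hd : ∀ k, 0 ≤ 1 - ‖b k‖ := fun k => by linarith [h.norm_lt_one k]
  -- The Forelli–Rudin sum at z = 0; it provides the majorant for uniform convergence on |z| < r.
  have hs : Summable fun k => (1 - ‖b k‖) ^ (2 - 1 / 4 : ℝ) := by
    have key := h.tsum_forelliRudin_le (by norm_num) (by norm_num) (γ := 1 / 4) (by norm_num)
      (by norm_num) (z := 0) (by simp)
    have hF := forelliRudinConst_pos (γ := 1 / 4) (by norm_num) (by norm_num)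
    simp only [mul_zero, sub_zero, norm_one, one_pow, inv_one, mul_one, norm_zero,
      Real.one_rpow] at key
    exact (summable_and_tsum_le_of_tsum_ofReal_le (fun k => Real.rpow_nonneg (hd k) _)
      (by positivity) key).1
  have hdiff : DifferentiableOn ℂ (kernelSeries b e) (ball 0 r) := by
    refine Complex.differentiableOn_tsum_of_summable_norm
      (u := fun k => (8 * ‖e‖ * ((1 - r) ^ 2)⁻¹) * (1 - ‖b k‖) ^ (2 - 1 / 4 : ℝ))
      (hs.mul_left _) (fun k => ?_) isOpen_ball fun k w hw => ?_
    · exact (((differentiableOn_normKernel (h.norm_lt_one k)).mono hsub).const_mul _).mul_const _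
    · have hw1 : ‖w‖ < r := by simpa using hw
      refine (h.norm_term_le e k w).trans ?_
      have h1 := rpow_neg_quarter_mul_norm_normKernel_le (h.norm_lt_one k) (hw1.trans hr)
      have h2 : (‖1 - conj (b k) * w‖ ^ 2)⁻¹ ≤ ((1 - r) ^ 2)⁻¹ := by
        have := one_sub_norm_le_right (z := w) (h.norm_lt_one k)
        have h3 : 1 - r ≤ ‖1 - conj (b k) * w‖ := by linarith
        gcongr
      calc (1 - ‖b k‖) ^ (-(1 / 4) : ℝ) * ‖normKernel (b k) w‖ * ‖e‖
          ≤ 8 * ((1 - ‖b k‖) ^ (2 - 1 / 4 : ℝ) * ((1 - r) ^ 2)⁻¹) * ‖e‖ := by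
            refine mul_le_mul_of_nonneg_right (h1.trans ?_) (norm_nonneg _)
            refine mul_le_mul_of_nonneg_left ?_ (by norm_num)
            exact mul_le_mul_of_nonneg_left h2 (Real.rpow_nonneg (hd k) _)
        _ = _ := by ring
  exact (hdiff.differentiableAt (isOpen_ball.mem_nhds (by simpa using hzr))).differentiableWithinAt

/-- If the kernels at `b` are almost orthogonal, some `kernelSeries` takes the values
`1, 0, 0, …` on `b`. -/
theorem exists_kernelSeries_eq (h : Separated (1 / 2) b)
    (hoff : ∀ j, ∑' k, (if k = j then 0 else
      (1 - ‖b k‖) ^ (-(1 / 4) : ℝ) * ‖normKernel (b k) (b j)‖) ≤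
        1 / 2 * (1 - ‖b j‖) ^ (-(1 / 4) : ℝ)) :
    ∃ e : ℕ →ᵇ ℂ, ∀ j, kernelSeries b e (b j) = if j = 0 then 1 else 0 := by
  set w : ℕ → ℝ := fun k => (1 - ‖b k‖) ^ (-(1 / 4) : ℝ) with hw
  have hw0 : ∀ k, 0 < w k := fun k => Real.rpow_pos_of_pos (by linarith [h.norm_lt_one k]) _
  -- Conjugating the off-diagonal kernel matrix by the weights turns `hoff` into row sums at most
  -- 1/2.
  set B : ℕ → ℕ → ℂ := fun j k =>
    if k = j then 0 else ((w j)⁻¹ : ℝ) * ((w k : ℂ) * normKernel (b k) (b j))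
  have hBn : ∀ j k, ‖B j k‖ =
      (w j)⁻¹ * (if k = j then 0 else w k * ‖normKernel (b k) (b j)‖) := by
    intro j k
    simp only [B]
    split_ifs
    · simp
    · rw [norm_mul, norm_mul, Complex.norm_real, Complex.norm_real,
        Real.norm_of_nonneg (inv_nonneg.2 (hw0 j).le), Real.norm_of_nonneg (hw0 k).le]
  have hsum : ∀ j, Summable fun k => (if k = j then 0 else w k * ‖normKernel (b k) (b j)‖) := by
    intro j
    refine (h.tsum_normKernel_le (h.norm_lt_one j)).1.of_nonneg_of_le (fun k => ?_) fun k => ?_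
    · split_ifs
      · exact le_rfl
      · exact mul_nonneg (hw0 k).le (norm_nonneg _)
    · split_ifs
      · exact mul_nonneg (hw0 k).le (norm_nonneg _)
      · exact le_rfl
  have hB : ∀ j, Summable fun k => ‖B j k‖ := fun j => by
    simp only [hBn]
    exact (hsum j).mul_left _
  have hB' : ∀ j, ∑' k, ‖B j k‖ ≤ 1 / 2 := fun j => by
    simp only [hBn]
    rw [tsum_mul_left, inv_mul_le_iff₀ (hw0 j), mul_comm]
    exact hoff j
  obtain ⟨e, he⟩ := exists_bounded_solution hB hB'
    (BoundedContinuousFunction.ofNormedAddCommGroupDiscrete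
      (fun j => if j = 0 then (((w 0)⁻¹ : ℝ) : ℂ) else 0) (w 0)⁻¹ (fun j => by
        split_ifs
        · rw [Complex.norm_real, Real.norm_of_nonneg (inv_nonneg.2 (hw0 0).le)]
        · simpa using (hw0 0).le))
  refine ⟨e, fun j => ?_⟩
  have hej := he j
  rw [BoundedContinuousFunction.coe_ofNormedAddCommGroupDiscrete] at hej
  have hwj : (w j : ℂ) ≠ 0 := Complex.ofReal_ne_zero.2 (hw0 j).ne'
  have hsplit : kernelSeries b e (b j) = w j * (e j + ∑' k, B j k * e k) := by
    have hs := (h.summable_term e (h.norm_lt_one j)).of_norm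
    rw [kernelSeries, hs.tsum_eq_add_tsum_ite j, mul_add, ← tsum_mul_left,
      normKernel_self (h.norm_lt_one j), mul_one]
    congr 1
    refine tsum_congr fun k => ?_
    simp only [B]
    split_ifs
    · simp
    · change (w k : ℂ) * normKernel (b k) (b j) * e k = _
      push_cast
      field_simp
  rw [hsplit, hej]
  split_ifs with hj
  · subst hj
    push_cast
    exact mul_inv_cancel₀ hwj
  · rw [mul_zero]

/-- The growth bound squares to (1 - |z|)^(-1/2), integrable by the Forelli–Rudin estimate at z = 0
with γ = 1/2. -/
theorem memBergman_kernelSeries (h : Separated (1 / 2) b) (e : ℕ →ᵇ ℂ) :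
    MemBergman (kernelSeries b e) := by
  have hdiff := h.differentiableOn_kernelSeries e
  refine ⟨hdiff, ?_, ?_⟩
  · exact (hdiff.continuousOn.aestronglyMeasurable measurableSet_disk).smul_measure _
  · rw [eLpNorm_lt_top_iff_lintegral_rpow_enorm_lt_top two_ne_zero ENNReal.ofNat_ne_top, area,
      lintegral_smul_measure, smul_eq_mul]
    refine ENNReal.mul_lt_top ENNReal.ofReal_lt_top ?_
    set M := 256 * forelliRudinConst (1 / 4) * ‖e‖ with hM
    have key := lintegral_disk_rpow_div_le (γ := 1 / 2) (by norm_num) (by norm_num) (z := 0)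
      (by simp)
    calc ∫⁻ z in disk, ‖kernelSeries b e z‖ₑ ^ (2 : ℝ≥0∞).toReal
        ≤ ∫⁻ z in disk, ENNReal.ofReal (M ^ 2) *
          ENNReal.ofReal ((1 - ‖z‖) ^ (-(1 / 2) : ℝ) * (‖1 - conj z * 0‖ ^ 2)⁻¹) := by
          refine setLIntegral_mono' measurableSet_disk fun z hz => ?_
          have hz1 := mem_disk_iff.1 hz
          have hz0 : 0 ≤ 1 - ‖z‖ := by linarith
          rw [← ENNReal.ofReal_mul (sq_nonneg _), ENNReal.toReal_ofNat,
            ← ofReal_norm, ENNReal.ofReal_rpow_of_nonneg (norm_nonneg _) (by norm_num)]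
          apply ENNReal.ofReal_le_ofReal
          rw [Real.rpow_ofNat]
          have h1 := h.norm_kernelSeries_le e hz1
          have e1 : (1 - ‖z‖) ^ (-(1 / 2) : ℝ) = ((1 - ‖z‖) ^ (-(1 / 4) : ℝ)) ^ 2 := by
            rw [← Real.rpow_mul_natCast hz0]; norm_num
          calc ‖kernelSeries b e z‖ ^ 2
              ≤ (256 * forelliRudinConst (1 / 4) * (1 - ‖z‖) ^ (-(1 / 4) : ℝ) * ‖e‖) ^ 2 := by
                gcongr
            _ = _ := by
                rw [e1, mul_zero, sub_zero, norm_one, hM]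
                ring
      _ < ∞ := by
          rw [lintegral_const_mul' _ _ ENNReal.ofReal_ne_top]
          exact ENNReal.mul_lt_top ENNReal.ofReal_lt_top (key.trans_lt ENNReal.ofReal_lt_top)

end Separated

/-! ### Large R: failure of uniqueness. -/

theorem MemBergman.sub_mul {f : ℂ → ℂ} (hf : MemBergman f) (c : ℂ) :
    MemBergman fun z => (z - c) * f z := by
  refine ⟨DifferentiableOn.mul (by fun_prop) hf.1, ?_⟩
  refine hf.2.of_le_mul (c := 1 + ‖c‖) ?_ ?_
  · exact (by fun_prop : Continuous fun z : ℂ => z - c).aestronglyMeasurable.mul hf.2.1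
  · have : ∀ᵐ z ∂(volume.restrict disk), z ∈ disk := ae_restrict_mem measurableSet_disk
    refine (Measure.ae_smul_measure this _).mono fun z hz => ?_
    rw [norm_mul]
    refine mul_le_mul_of_nonneg_right ((norm_sub_le _ _).trans ?_) (norm_nonneg _)
    linarith [mem_disk_iff.1 hz]

theorem setLIntegral_area_ne_zero {f : ℂ → ℂ} (hf : DifferentiableOn ℂ f disk) {c : ℂ}
    (hc : c ∈ disk) (hfc : f c ≠ 0) : ∫⁻ z in disk, ‖f z‖ₑ ^ 2 ∂area ≠ 0 := by
  have hc1 : 0 < 1 - ‖c‖ := by linarith [mem_disk_iff.1 hc]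
  have hsub : ball c (1 - ‖c‖) ⊆ disk := ball_subset_ball' (by simp)
  rw [setLIntegral_area]
  refine mul_ne_zero (by simpa using Real.pi_pos) (ne_of_gt ?_)
  refine lt_of_lt_of_le ?_ ((volume_ball_mul_sq_le (hf.mono hsub)).trans (lintegral_mono_set hsub))
  refine ENNReal.mul_pos (measure_ball_pos _ _ hc1).ne' ?_
  simpa using hfc

/-- A reverse Carleson measure `pointMeasure b` makes `b` a uniqueness set. -/
theorem IsReverseCarleson.eq_zero {b : ℕ → ℂ} (hb : ∀ k, b k ∈ disk)
    (h : IsReverseCarleson (pointMeasure b)) {f : ℂ → ℂ} (hf : MemBergman f)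
    (h0 : ∀ k, f (b k) = 0) {c : ℂ} (hc : c ∈ disk) : f c = 0 := by
  by_contra hfc
  obtain ⟨C, hC, hle⟩ := h
  have h1 := hle f hf
  rw [setLIntegral_pointMeasure hb] at h1
  simp only [h0, enorm_zero, ne_eq, OfNat.ofNat_ne_zero, not_false_eq_true, zero_pow, mul_zero,
    tsum_zero, nonpos_iff_eq_zero, mul_eq_zero, ENNReal.ofReal_eq_zero] at h1
  exact h1.elim (fun h2 => absurd hC h2.not_gt) (setLIntegral_area_ne_zero hf.1 hc hfc)

theorem not_isReverseCarleson_of_tanh_gt {R : ℝ} {b : ℕ → ℂ} (h : IsLattice R b)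
    (h1 : 1 / 2 ≤ Real.tanh (R / 2))
    (h2 : 1 - Real.tanh (R / 2) ^ 2 ≤ (1 / (512 * forelliRudinConst (1 / 8))) ^ 8) :
    ¬ IsReverseCarleson (pointMeasure b) := by
  intro hrc
  have hF := forelliRudinConst_pos (γ := 1 / 8) (by norm_num) (by norm_num)
  have hsep : Separated (1 / 2) b := h.toSeparated (by norm_num) h1
  set t := Real.tanh (R / 2) with ht
  have ht1 : t < 1 := Real.tanh_lt_one _
  have hη0 : 0 ≤ 1 - t ^ 2 := by nlinarith
  -- This is 1 - ρ² ≤ 1 - t² with the squares on the left weakened to first powers.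
  have hη : ∀ k j, k ≠ j →
      (1 - ‖b k‖) * (1 - ‖b j‖) ≤ (1 - t ^ 2) * ‖1 - conj (b k) * b j‖ ^ 2 := by
    intro k j hkj
    have h3 := h.tanh_mul_le hkj
    have h4 := norm_one_sub_conj_mul_sq (b k) (b j)
    have h5 : (t * ‖1 - conj (b k) * b j‖) ^ 2 ≤ ‖b k - b j‖ ^ 2 := by
      gcongr
    have hk := h.norm_lt_one k
    have hj := h.norm_lt_one j
    have h6 : (1 - ‖b k‖) * (1 - ‖b j‖) ≤ (1 - ‖b k‖ ^ 2) * (1 - ‖b j‖ ^ 2) := by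
      have hk0 := norm_nonneg (b k)
      have hj0 := norm_nonneg (b j)
      apply mul_le_mul <;> nlinarith
    rw [mul_pow] at h5
    linarith
  have hroot : (1 - t ^ 2) ^ (1 / 8 : ℝ) ≤ 1 / (512 * forelliRudinConst (1 / 8)) := by
    refine (Real.rpow_le_rpow hη0 h2 (by norm_num)).trans_eq ?_
    rw [← Real.rpow_natCast, ← Real.rpow_mul (by positivity)]
    norm_num
  obtain ⟨e, he⟩ := hsep.exists_kernelSeries_eq fun j => by
    refine (hsep.tsum_offDiagonal_le hη0 hη j).trans ?_
    refine mul_le_mul_of_nonneg_right ?_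
      (Real.rpow_nonneg (by linarith [h.norm_lt_one j]) _)
    refine (mul_le_mul_of_nonneg_left hroot (by positivity)).trans_eq ?_
    field_simp
    norm_num
  have hf := hsep.memBergman_kernelSeries e
  have hzero : ∀ k, (b k - b 0) * kernelSeries b e (b k) = 0 := by
    intro k
    rw [he]
    split_ifs with hk
    · rw [hk, sub_self, zero_mul]
    · rw [mul_zero]
  have hall : ∀ c ∈ disk, (c - b 0) * kernelSeries b e c = 0 := fun c hc =>
    hrc.eq_zero h.mem_disk (hf.sub_mul (b 0)) hzero hc
  -- The product vanishes at `b 0` itself, so the contradiction is read off at a nearby c ≠ `b 0`.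
  have hcont : ContinuousAt (kernelSeries b e) (b 0) :=
    hf.1.continuousOn.continuousAt (isOpen_disk.mem_nhds (h.mem_disk 0))
  have hne : kernelSeries b e (b 0) ≠ 0 := by rw [he]; simp
  have hev := (hcont.eventually_ne hne).and (isOpen_disk.mem_nhds (h.mem_disk 0))
  obtain ⟨c, ⟨hc1, hc2⟩, hc3⟩ :=
    ((hev.filter_mono nhdsWithin_le_nhds).and self_mem_nhdsWithin : ∀ᶠ c in
      nhdsWithin (b 0) {b 0}ᶜ, _).exists
  exact mul_ne_zero (sub_ne_zero.2 hc3) hc1 (hall c hc2)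

end Bergman

/-! ### Choice of the absolute constants. -/

theorem mainTheorem8 :
    (∀ (R : ℝ) (b : ℕ → ℂ), 0 < R → Bergman.IsLattice R b →
      IsFiniteMeasure (Bergman.pointMeasure b)) ∧
    (∃ R₀ : ℝ, 0 < R₀ ∧ ∀ (R : ℝ) (b : ℕ → ℂ), 0 < R → R < R₀ → Bergman.IsLattice R b →
      Bergman.IsReverseCarleson (Bergman.pointMeasure b)) ∧
    (∃ R₁ : ℝ, 0 < R₁ ∧ ∀ (R : ℝ) (b : ℕ → ℂ), R₁ < R → Bergman.IsLattice R b →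
      ¬ Bergman.IsReverseCarleson (Bergman.pointMeasure b)) := by
  refine ⟨fun R b hR h => Bergman.isFiniteMeasure_pointMeasure hR h,
    ⟨Real.artanh (1 / 2 ^ 14), Real.artanh_pos ⟨by norm_num, by norm_num⟩, ?_⟩, ?_⟩
  · intro R b hR hR0 h
    refine Bergman.isReverseCarleson_of_tanh_le hR h ?_
    have := Bergman.tanh_strictMono hR0
    rw [Real.tanh_artanh ⟨by norm_num, by norm_num⟩] at this
    exact this.le
  · set ε : ℝ := (1 / (512 * Bergman.forelliRudinConst (1 / 8))) ^ 8 with hε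
    have hε0 : 0 < ε := by
      have := Bergman.forelliRudinConst_pos (γ := 1 / 8) (by norm_num) (by norm_num)
      positivity
    -- For t > s, 1/2 gives the separation constant, and 1 - t² ≤ 2(1 - t) < ε gives the
    -- off-diagonal smallness.
    set s : ℝ := max (1 / 2) (1 - ε / 2) with hs
    have hs1 : s < 1 := max_lt (by norm_num) (by linarith)
    have hs2 : 1 / 2 ≤ s := le_max_left _ _
    have hs3 : 1 - ε / 2 ≤ s := le_max_right _ _
    have hs0 : 0 < s := by linarith
    refine ⟨2 * Real.artanh s, mul_pos two_pos (Real.artanh_pos ⟨hs0, hs1⟩), ?_⟩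
    intro R b hR h
    have ht := Bergman.tanh_strictMono (show Real.artanh s < R / 2 by linarith)
    rw [Real.tanh_artanh ⟨by linarith, hs1⟩] at ht
    have ht1 := Real.tanh_lt_one (R / 2)
    refine Bergman.not_isReverseCarleson_of_tanh_gt h (by linarith) ?_
    nlinarith
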